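/- Let $L:=L^2(0,1)$ (real-valued) and let $\mu^{BB}$ be the law on $L$ of the Brownian bridge from $0$ to $0$, i.e. the centered Gaussian measure on $L$ with covariance operator $(Q\eta)_t=\int_0^1 (t\wedge s-ts)\,\eta_s\,ds$. Let $$\mathcal{F}C_b^\infty(L):=\{g((\eta_1,\cdot)_L,\dots,(\eta_k,\cdot)_L) : k\in\mathbb{N},\ g\in C_b^\infty(\mathbb{R}^k),\ \eta_1,\dots,\eta_k\in L\},$$ where $C_b^\infty(\mathbb{R}^k)$ is the space of smooth real functions that are bounded together with all their derivatives, and let $\exp(L)$ (resp. $\exp(C^\infty)$) be the real linear span of the functions $\sin((\eta,\cdot)_L)$ and $\cos((\eta,\cdot)_L)$ with $\eta\in L$ (resp. $\eta\in C^\infty[0,1]$). For differentiable $F:L\to\mathbb{R}$ let $\nabla F:L\to L$ be its Fr\'echet gradient. The Sobolev space $W^{1,2}(L;\mu^{BB})$ with its weak gradient, again denoted by $\nabla$, is obtained by closing the operator $\exp(L)\ni F\mapsto\nabla F$ from $L^2(L;\mu^{BB})$ to $L^2(L;\mu^{BB};L)$, and carries the norm $\|u\|_{W^{1,2}}^2=\|u\|^2_{L^2(L;\mu^{BB})}+\|\nabla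 u\|^2_{L^2(L;\mu^{BB};L)}$. The operator is closable, so that the weak gradient is well defined, and: (i) For every $F\in\mathcal{F}C_b^\infty(L)$ the function $F\circ|\cdot|$, $f\mapsto F(|f|)$, belongs to $W^{1,2}(L;\mu^{BB})$, and its weak gradient is $\nabla(F\circ|\cdot|)(f)=\mathrm{sgn}(f)\,\nabla F(|f|)$ for $\mu^{BB}$-a.e. $f\in L$. (ii) $\exp(C^\infty)$ is (contained and) dense in $W^{1,2}(L;\mu^{BB})$. -/

import Mathlib

open MeasureTheory ProbabilityTheory Filter Topology
open scoped RealInnerProductSpace ENNReal Gradient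

/-- Lebesgue measure on the interval `(0, 1)`. -/
noncomputable abbrev vol01 : Measure ℝ := volume.restrict (Set.Ioo 0 1)

/-- The real Hilbert space `L = L²(0, 1)`, with its Borel σ-algebra. -/
noncomputable abbrev L01 : Type := Lp ℝ 2 vol01

noncomputable instance : MeasurableSpace L01 := borel L01

instance : BorelSpace L01 := ⟨rfl⟩

instance : SecondCountableTopology L01 :=
  haveI : Fact ((2 : ℝ≥0∞) ≠ ∞) := ⟨by simp⟩
  inferInstanceAs (SecondCountableTopology (Lp ℝ 2 vol01))

/-- `μ` is the law on `L²(0, 1)` of a Brownian bridge from `0` to `0`: the centered Gaussian measure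
whose covariance operator is `(Q η)_t = ∫₀¹ (t ∧ s - t s) η_s ds`, i.e. the covariance of
`(η, ·)` and `(ξ, ·)` under `μ` is `(Q η, ξ)`. -/
structure IsBrownianBridgeLaw (μ : Measure L01) : Prop where
  isGaussian : IsGaussian μ
  mean_eq_zero : ∫ f, f ∂μ = 0
  covariance_eq : ∀ η ξ : L01, covarianceBilin μ η ξ =
    ∫ t, (∫ s, (min t s - t * s) * η s ∂vol01) * ξ t ∂vol01

theorem IsBrownianBridgeLaw.unique {μ ν : Measure L01} (hμ : IsBrownianBridgeLaw μ)
    (hν : IsBrownianBridgeLaw ν) : μ = ν := by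
  have := hμ.isGaussian
  have := hν.isGaussian
  refine IsGaussian.ext ?_ ?_
  · exact hμ.mean_eq_zero.trans hν.mean_eq_zero.symm
  · ext η ξ
    rw [hμ.covariance_eq, hν.covariance_eq]

/-! Auxiliary: Gaussian series in a Hilbert space, used to show that the Brownian bridge law exists. -/

theorem exists_bilin_hasSum {E : Type*} [NormedAddCommGroup E] [InnerProductSpace ℝ E]
    (a : ℕ → E) (ha : Summable fun n => ‖a n‖ ^ 2) :
    ∃ B : E →L[ℝ] E →L[ℝ] ℝ, ∀ x y, HasSum (fun n => ⟪a n, x⟫ * ⟪a n, y⟫) (B x y) := by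
  have hbd : ∀ x y n, ‖⟪a n, x⟫ * ⟪a n, y⟫‖ ≤ ‖a n‖ ^ 2 * (‖x‖ * ‖y‖) := fun x y n => by
    rw [norm_mul]
    calc ‖⟪a n, x⟫‖ * ‖⟪a n, y⟫‖ ≤ (‖a n‖ * ‖x‖) * (‖a n‖ * ‖y‖) := by
          gcongr <;> exact norm_inner_le_norm _ _
      _ = _ := by ring
  have hs : ∀ x y, Summable fun n => ⟪a n, x⟫ * ⟪a n, y⟫ := fun x y =>
    Summable.of_norm_bounded (ha.mul_right _) (hbd x y)
  let B₀ : E →ₗ[ℝ] E →ₗ[ℝ] ℝ := LinearMap.mk₂ ℝ (fun x y => ∑' n, ⟪a n, x⟫ * ⟪a n, y⟫)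
    (fun x x' y => by
      rw [← (hs x y).tsum_add (hs x' y)]
      exact tsum_congr fun n => by rw [inner_add_right]; ring)
    (fun c x y => by
      rw [smul_eq_mul, ← tsum_mul_left]
      exact tsum_congr fun n => by rw [real_inner_smul_right]; ring)
    (fun x y y' => by
      rw [← (hs x y).tsum_add (hs x y')]
      exact tsum_congr fun n => by rw [inner_add_right]; ring)
    (fun c x y => by
      rw [smul_eq_mul, ← tsum_mul_left]
      exact tsum_congr fun n => by rw [real_inner_smul_right]; ring)
  refine ⟨B₀.mkContinuous₂ (∑' n, ‖a n‖ ^ 2) fun x y => ?_, fun x y => (hs x y).hasSum⟩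
  have h := tsum_of_norm_bounded (ha.hasSum.mul_right (‖x‖ * ‖y‖)) (hbd x y)
  simpa [B₀, mul_assoc] using h

theorem exists_gaussian_series {E : Type*} [NormedAddCommGroup E] [InnerProductSpace ℝ E]
    [CompleteSpace E] [SecondCountableTopology E] [MeasurableSpace E] [BorelSpace E]
    (a : ℕ → E) (ha : Summable fun n => ‖a n‖ ^ 2) :
    ∃ μ : Measure E, IsGaussian μ ∧ ∫ x, x ∂μ = 0 ∧
      ∀ x y, HasSum (fun n => ⟪a n, x⟫ * ⟪a n, y⟫) (covarianceBilin μ x y) := by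
  classical
  set P : Measure (ℕ → ℝ) := Measure.infinitePi fun _ : ℕ => gaussianReal 0 1 with hP
  have hmp : ∀ n, MeasurePreserving (fun ω : ℕ → ℝ => ω n) P (gaussianReal 0 1) :=
    fun n => measurePreserving_eval_infinitePi _ n
  have hind : iIndepFun (fun n (ω : ℕ → ℝ) => ω n) P :=
    iIndepFun_infinitePi (X := fun _ x => x) (fun _ => measurable_id)
  have hL2 : ∀ n, MemLp (fun ω : ℕ → ℝ => ω n) 2 P := fun n =>
    (memLp_id_gaussianReal 2).comp_measurePreserving (hmp n)
  have hmean : ∀ n, ∫ ω, ω n ∂P = 0 := fun n => by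
    have h := integral_map (μ := P) (φ := fun ω : ℕ → ℝ => ω n)
      (f := fun x : ℝ => x)
      (hmp n).measurable.aemeasurable (by fun_prop)
    rw [(hmp n).map_eq, integral_id_gaussianReal] at h
    exact h.symm
  have hsq : ∀ n, ∫ ω, ω n * ω n ∂P = 1 := fun n => by
    have h := integral_map (μ := P) (φ := fun ω : ℕ → ℝ => ω n)
      (f := fun x : ℝ => x * x)
      (hmp n).measurable.aemeasurable (by fun_prop)
    rw [(hmp n).map_eq] at h
    rw [← h]
    have hv := variance_fun_id_gaussianReal (μ := 0) (v := 1)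
    rw [variance_of_integral_eq_zero (by fun_prop) integral_id_gaussianReal] at hv
    simpa [sq] using hv
  have hcross : ∀ m n, m ≠ n → ∫ ω, ω m * ω n ∂P = 0 := fun m n hmn => by
    rw [(hind.indepFun hmn).integral_fun_mul_eq_mul_integral
      (hL2 m).1 (hL2 n).1, hmean, zero_mul]
  have hfm : ∀ n, MemLp (fun ω : ℕ → ℝ => ω n • a n) 2 P := fun n =>
    ((ContinuousLinearMap.id ℝ ℝ).smulRight (a n)).comp_memLp' (hL2 n)
  let f : ℕ → Lp E 2 P := fun n => (hfm n).toLp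
  have hfi : ∀ m n, ⟪f m, f n⟫ = (∫ ω, ω m * ω n ∂P) * ⟪a m, a n⟫ := fun m n => by
    rw [L2.inner_def, ← integral_mul_const]
    refine integral_congr_ae ?_
    filter_upwards [(hfm m).coeFn_toLp, (hfm n).coeFn_toLp] with ω h1 h2
    simp only [f, h1, h2, inner_smul_left, inner_smul_right]
    simp; ring
  have hfsum : Summable f := by
    have hV : OrthogonalFamily ℝ (fun n => Submodule.span ℝ {f n})
        (fun n => (Submodule.span ℝ {f n}).subtypeₗᵢ) := by
      refine OrthogonalFamily.of_pairwise fun m n hmn => ?_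
      change Submodule.span ℝ {f m} ⟂ Submodule.span ℝ {f n}
      rw [Submodule.isOrtho_span]
      rintro u rfl v rfl
      rw [hfi, hcross m n hmn, zero_mul]
    have := (hV.summable_iff_norm_sq_summable
      fun n => ⟨f n, Submodule.mem_span_singleton_self _⟩).2 (by
        refine ha.congr fun n => ?_
        simp only [Submodule.coe_norm]
        rw [← real_inner_self_eq_norm_sq, ← real_inner_self_eq_norm_sq, hfi, hsq, one_mul])
    exact this
  set X : Lp E 2 P := ∑' n, f n
  have hXm : AEMeasurable X P := (Lp.aestronglyMeasurable X).aemeasurable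
  have hlim : Tendsto (fun N => ∑ n ∈ Finset.range N, f n) atTop (𝓝 X) :=
    hfsum.hasSum.tendsto_sum_nat
  obtain ⟨ns, hns, hae⟩ := (tendstoInMeasure_of_tendsto_Lp hlim).exists_seq_tendsto_ae
  have hpart : ∀ N, (∑ n ∈ Finset.range N, f n : Lp E 2 P) =ᵐ[P]
      fun ω => ∑ n ∈ Finset.range N, ω n • a n := fun N => by
    have h1 := Lp.coeFn_finsetSum (Finset.range N) f
    have h2 : ∀ᵐ ω ∂P, ∀ n, f n ω = ω n • a n :=
      ae_all_iff.2 fun n => (hfm n).coeFn_toLp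
    filter_upwards [h1, h2] with ω h1 h2
    rw [h1, Finset.sum_apply]
    exact Finset.sum_congr rfl fun n _ => h2 n
  obtain ⟨B, hBs⟩ := exists_bilin_hasSum a ha
  have hBpos : B.toBilinForm.IsPosSemidef := by
    refine ⟨⟨fun x y => ?_⟩, ⟨fun x => ?_⟩⟩
    · simpa using (hBs x y).unique ((hBs y x).congr_fun fun n => mul_comm _ _)
    · exact (hBs x x).nonneg fun n => mul_self_nonneg _
  have : IsProbabilityMeasure (P.map X) := Measure.isProbabilityMeasure_map hXm
  have hchar : ∀ t, charFun (P.map X) t = Complex.exp (⟪t, (0 : E)⟫ * Complex.I - B t t / 2) := by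
    intro t
    rw [charFun_apply, integral_map hXm (by fun_prop)]
    have hS : ∀ N, ∫ ω, Complex.exp (⟪∑ n ∈ Finset.range N, ω n • a n, t⟫ * Complex.I) ∂P
        = Complex.exp (-((∑ n ∈ Finset.range N, ⟪a n, t⟫ * ⟪a n, t⟫ : ℝ) : ℂ) / 2) := by
      intro N
      have hi := (hind.precomp (g := fun i : Fin N => (i : ℕ)) Fin.val_injective).integral_fun_prod_comp
        (f := fun (i : Fin N) (x : ℝ) => Complex.exp ((⟪a i, t⟫ * x : ℝ) * Complex.I))
        (fun i => (hmp i).measurable.aemeasurable) (fun i => by fun_prop)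
      have he : ∀ i : Fin N, ∫ ω, Complex.exp ((⟪a i, t⟫ * ω i : ℝ) * Complex.I) ∂P
          = Complex.exp (-((⟪a i, t⟫ * ⟪a i, t⟫ : ℝ) : ℂ) / 2) := fun i => by
        have h := integral_map (μ := P) (φ := fun ω : ℕ → ℝ => ω i)
          (f := fun x : ℝ => Complex.exp ((⟪a i, t⟫ * x : ℝ) * Complex.I))
          (hmp i).measurable.aemeasurable (by fun_prop)
        rw [← h, (hmp i).map_eq]
        have hc := charFun_gaussianReal (μ := 0) (v := 1) ⟪a i, t⟫
        rw [charFun_apply_real] at hc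
        push_cast
        rw [hc]
        simp [sq, neg_div]
      simp_rw [he, ← Complex.exp_sum] at hi
      refine Eq.trans (integral_congr_ae (ae_of_all _ fun ω => ?_)) (hi.trans ?_)
      · dsimp only
        congr 1
        rw [← Finset.sum_mul, ← Complex.ofReal_sum,
          Fin.sum_univ_eq_sum_range (fun n => ⟪a n, t⟫ * ω n), sum_inner]
        congr 2
        exact Finset.sum_congr rfl fun n _ => by rw [real_inner_smul_left, mul_comm]
      · congr 1
        rw [← Finset.sum_div, Finset.sum_neg_distrib, ← Complex.ofReal_sum,
          Fin.sum_univ_eq_sum_range (fun n => ⟪a n, t⟫ * ⟪a n, t⟫)]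
    have hl1 : Tendsto (fun k => ∫ ω, Complex.exp
        (⟪∑ n ∈ Finset.range (ns k), ω n • a n, t⟫ * Complex.I) ∂P) atTop
        (𝓝 (∫ ω, Complex.exp (⟪X ω, t⟫ * Complex.I) ∂P)) := by
      refine tendsto_integral_of_dominated_convergence (fun _ => 1) ?_ ?_ ?_ ?_
      · intro k
        refine Measurable.aestronglyMeasurable ?_
        fun_prop
      · exact integrable_const _
      · intro k; filter_upwards with ω
        rw [Complex.norm_exp_ofReal_mul_I]
      · filter_upwards [hae, ae_all_iff.2 hpart] with ω h1 h2
        simp_rw [h2] at h1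
        have := (Complex.continuous_exp.comp ((Complex.continuous_ofReal.comp
          (continuous_id.inner (continuous_const (y := t)))).mul (continuous_const (y := Complex.I)))).tendsto (X ω)
        exact this.comp h1
    have hl2 : Tendsto (fun k => Complex.exp
        (-((∑ n ∈ Finset.range (ns k), ⟪a n, t⟫ * ⟪a n, t⟫ : ℝ) : ℂ) / 2)) atTop
        (𝓝 (Complex.exp (-((B t t : ℝ) : ℂ) / 2))) := by
      have h1 := (hBs t t).tendsto_sum_nat.comp hns.tendsto_atTop
      have h2 : Continuous fun r : ℝ => Complex.exp (-(r : ℂ) / 2) := by fun_prop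
      exact (h2.tendsto _).comp h1
    simp_rw [hS] at hl1
    rw [tendsto_nhds_unique hl1 hl2]
    simp [neg_div]
  have hG : IsGaussian (P.map X) := isGaussian_iff_gaussian_charFun.2 ⟨0, B, hBpos, hchar⟩
  obtain ⟨h0, hB'⟩ := gaussian_charFun_congr 0 B hBpos hchar
  exact ⟨P.map X, hG, h0.symm, fun x y => hB' ▸ hBs x y⟩

/-- Sine expansion of the Brownian bridge covariance. -/
theorem kernel_hasSum {s t : ℝ} (hs : s ∈ Set.Ioo (0 : ℝ) 1) (ht : t ∈ Set.Ioo (0 : ℝ) 1) :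
    HasSum (fun n : ℕ => √2 * Real.sin (n * Real.pi * t) / (n * Real.pi) *
      (√2 * Real.sin (n * Real.pi * s) / (n * Real.pi))) (min t s - t * s) := by
  wlog hst : s ≤ t generalizing s t
  · have := this ht hs (le_of_not_ge hst)
    rw [min_comm, mul_comm t s]
    exact this.congr_fun fun n => mul_comm _ _
  have h1 := hasSum_one_div_nat_pow_mul_cos one_ne_zero
    (x := (t - s) / 2) ⟨by linarith, by linarith [hs.1, ht.2]⟩
  have h2 := hasSum_one_div_nat_pow_mul_cos one_ne_zero
    (x := (t + s) / 2) ⟨by linarith [hs.1, ht.1], by linarith [hs.2, ht.2]⟩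
  have hb : ∀ x : ℝ, (Polynomial.map (algebraMap ℚ ℝ) (Polynomial.bernoulli (2 * 1))).eval x
      = x ^ 2 - x + 1 / 6 := by
    intro x
    simp only [mul_one, Polynomial.bernoulli, Finset.sum_range_succ, Finset.sum_range_zero]
    rw [bernoulli_one, bernoulli_eq_bernoulli'_of_ne_one (by decide : 2 ≠ 1), bernoulli'_two]
    simp
    ring
  rw [hb] at h1 h2
  have h3 := (h1.sub h2).mul_left (1 / Real.pi ^ 2)
  refine (congr_arg₂ HasSum ?_ ?_).to_iff.mp h3
  · funext n
    have e1 : 2 * Real.pi * n * ((t - s) / 2) = n * Real.pi * t - n * Real.pi * s := by ring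
    have e2 : 2 * Real.pi * n * ((t + s) / 2) = n * Real.pi * t + n * Real.pi * s := by ring
    rw [e1, e2, Real.cos_sub, Real.cos_add]
    have h2 : √2 * √2 = (2 : ℝ) := Real.mul_self_sqrt (by norm_num)
    generalize Real.sin (n * Real.pi * t) = A
    generalize Real.sin (n * Real.pi * s) = B
    rcases eq_or_ne (n : ℝ) 0 with h | h
    · simp [h]
    have := Real.pi_ne_zero
    field_simp
    linear_combination -(n : ℝ) ^ 2 * A * B * h2
  · rw [min_eq_right hst]
    have := Real.pi_ne_zero
    simp
    field_simp
    ring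

theorem exists_isBrownianBridgeLaw : ∃ μ : Measure L01, IsBrownianBridgeLaw μ := by
  let φ : ℕ → ℝ → ℝ := fun n t => √2 * Real.sin (n * Real.pi * t) / (n * Real.pi)
  have hφc : ∀ n, Continuous (φ n) := fun n => by fun_prop
  let C : ℕ → ℝ := fun n => √2 / Real.pi * (1 / n)
  have hC0 : ∀ n, 0 ≤ C n := fun n => by positivity
  have hφb : ∀ n t, ‖φ n t‖ ≤ C n := fun n t => by
    simp only [φ, C, norm_div, norm_mul, Real.norm_eq_abs]
    rw [abs_of_nonneg (Real.sqrt_nonneg 2), abs_of_nonneg Real.pi_pos.le,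
      abs_of_nonneg (Nat.cast_nonneg n : (0 : ℝ) ≤ n), div_mul_div_comm, mul_comm Real.pi]
    gcongr
    exact Real.abs_sin_le_one _
  have hφm : ∀ n, MemLp (φ n) 2 vol01 := fun n =>
    MemLp.of_bound (hφc n).aestronglyMeasurable (C n) (ae_of_all _ (hφb n))
  let a : ℕ → L01 := fun n => (hφm n).toLp
  have hCs : Summable fun n => C n ^ 2 := by
    simp only [C, mul_pow]
    refine Summable.mul_left _ ?_
    simp
  have hin : ∀ n (x : L01), ⟪a n, x⟫ = ∫ t, φ n t * x t ∂vol01 := fun n x => by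
    rw [L2.inner_def]
    refine integral_congr_ae ?_
    filter_upwards [(hφm n).coeFn_toLp] with t ht
    simp only [a, ht]
    simp [mul_comm]
  have ha : Summable fun n => ‖a n‖ ^ 2 := by
    refine hCs.of_nonneg_of_le (fun n => by positivity) fun n => ?_
    have h : ‖a n‖ ≤ C n := by
      have := Lp.norm_le_of_ae_bound (f := a n) (hC0 n) (by
        filter_upwards [(hφm n).coeFn_toLp] with t ht
        simp only [a, ht]; exact hφb n t)
      simpa [measureUnivNNReal] using this
    gcongr
  obtain ⟨μ, h1, h2, h3⟩ := exists_gaussian_series a ha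
  refine ⟨μ, h1, h2, fun η ξ => (h3 η ξ).unique ?_⟩
  have hint : ∀ x : L01, Integrable x vol01 := fun x =>
    (Lp.memLp x).integrable (by norm_num)
  have hg : Integrable (fun p : ℝ × ℝ => ξ p.1 * η p.2) (vol01.prod vol01) :=
    (hint ξ).mul_prod (hint η)
  let F : ℕ → ℝ × ℝ → ℝ := fun n p => (φ n p.1 * φ n p.2) * (ξ p.1 * η p.2)
  have hFb : ∀ n (p : ℝ × ℝ), ‖φ n p.1 * φ n p.2‖ ≤ C n ^ 2 := fun n p => by
    rw [norm_mul, sq]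
    exact mul_le_mul (hφb _ _) (hφb _ _) (norm_nonneg _) (hC0 n)
  have hFi : ∀ n, Integrable (F n) (vol01.prod vol01) := fun n =>
    hg.bdd_mul (c := C n ^ 2) (by fun_prop) (ae_of_all _ (hFb n))
  have hFs : Summable fun n => ∫ p, ‖F n p‖ ∂(vol01.prod vol01) := by
    refine (hCs.mul_right (∫ p, ‖ξ p.1 * η p.2‖ ∂(vol01.prod vol01))).of_nonneg_of_le
      (fun n => integral_nonneg fun _ => norm_nonneg _) fun n => ?_
    rw [← integral_const_mul]
    refine integral_mono (hFi n).norm (hg.norm.const_mul _) fun p => ?_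
    simp only [F]
    rw [norm_mul]
    exact mul_le_mul_of_nonneg_right (hFb n p) (norm_nonneg _)
  have key := hasSum_integral_of_summable_integral_norm hFi hFs
  have hmem : ∀ᵐ p ∂(vol01.prod vol01), p.1 ∈ Set.Ioo (0 : ℝ) 1 ∧ p.2 ∈ Set.Ioo (0 : ℝ) 1 := by
    rw [Measure.prod_restrict]
    exact ae_restrict_mem (measurableSet_Ioo.prod measurableSet_Ioo)
  have hK : (fun p => ∑' n, F n p) =ᵐ[vol01.prod vol01]
      fun p => ((min p.1 p.2 - p.1 * p.2) * η p.2) * ξ p.1 := by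
    filter_upwards [hmem] with p hp
    simp only [F]
    rw [tsum_mul_right, (kernel_hasSum hp.2 hp.1).tsum_eq]
    ring
  have hKi : Integrable (fun p : ℝ × ℝ => ((min p.1 p.2 - p.1 * p.2) * η p.2) * ξ p.1)
      (vol01.prod vol01) := by
    have : Integrable (fun p : ℝ × ℝ => (min p.1 p.2 - p.1 * p.2) * (ξ p.1 * η p.2))
        (vol01.prod vol01) := by
      refine hg.bdd_mul (c := 1) (by fun_prop) ?_
      filter_upwards [hmem] with p hp
      rw [Real.norm_eq_abs, abs_le]
      obtain ⟨⟨a1, a2⟩, b1, b2⟩ := hp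
      constructor
      · have := le_min a1.le b1.le
        nlinarith
      · have := min_le_left p.1 p.2
        nlinarith
    exact this.congr (ae_of_all _ fun p => by ring)
  rw [integral_congr_ae hK, integral_prod _ hKi] at key
  simp only [integral_mul_const] at key
  refine key.congr_fun fun n => ?_
  simp only [F]
  rw [hin, hin, mul_comm, ← integral_prod_mul]
  exact integral_congr_ae (ae_of_all _ fun p => by simp only; ring)

/-- The law `μ^{BB}` of the Brownian bridge on `L²(0, 1)`; it is unique by
`IsBrownianBridgeLaw.unique`. -/
noncomputable def brownianBridgeLaw : Measure L01 := exists_isBrownianBridgeLaw.choose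

theorem isBrownianBridgeLaw_brownianBridgeLaw : IsBrownianBridgeLaw brownianBridgeLaw :=
  exists_isBrownianBridgeLaw.choose_spec

/-- `C_b^∞(ℝᵏ)`: smooth functions that are bounded together with all their derivatives. -/
def IsCbInfty {k : ℕ} (g : (Fin k → ℝ) → ℝ) : Prop :=
  ContDiff ℝ (⊤ : ℕ∞) g ∧ ∀ n : ℕ, ∃ C : ℝ, ∀ x, ‖iteratedFDeriv ℝ n g x‖ ≤ C

/-- `FC_b^∞(L)`: the functions `f ↦ g((η₁, f), …, (η_k, f))` with `g ∈ C_b^∞(ℝᵏ)`, `η_i ∈ L`. -/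
def cylindricalCbInfty : Set (L01 → ℝ) :=
  {F | ∃ (k : ℕ) (g : (Fin k → ℝ) → ℝ) (η : Fin k → L01),
    IsCbInfty g ∧ F = fun f => g fun i => ⟪η i, f⟫}

/-- The linear span of the functions `sin((η, ·))`, `cos((η, ·))` with `η ∈ S`. -/
def trigSpan (S : Set L01) : Submodule ℝ (L01 → ℝ) :=
  Submodule.span ℝ
    ({F | ∃ η ∈ S, F = fun f => Real.sin ⟪η, f⟫} ∪ {F | ∃ η ∈ S, F = fun f => Real.cos ⟪η, f⟫})

/-- `exp(L)`. -/
def expL : Submodule ℝ (L01 → ℝ) := trigSpan Set.univ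

/-- `C^∞[0, 1]`, as a subset of `L`. -/
def smooth01 : Set L01 :=
  {η | ∃ φ : ℝ → ℝ, ContDiffOn ℝ (⊤ : ℕ∞) φ (Set.Icc 0 1) ∧ η =ᵐ[vol01] φ}

/-- `exp(C^∞)`. -/
def expSmooth : Submodule ℝ (L01 → ℝ) := trigSpan smooth01

/-- `v` is a weak gradient of `u`: the pair `(u, v)` lies in the closure, in
`L²(L; μ^{BB}) × L²(L; μ^{BB}; L)`, of the graph `{(F, ∇F) | F ∈ exp(L)}` of the
Fréchet gradient. -/
def HasWeakGradient (u : Lp ℝ 2 brownianBridgeLaw) (v : Lp L01 2 brownianBridgeLaw) : Prop :=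
  (u, v) ∈ closure {p : Lp ℝ 2 brownianBridgeLaw × Lp L01 2 brownianBridgeLaw |
    ∃ F ∈ expL, p.1 =ᵐ[brownianBridgeLaw] F ∧ p.2 =ᵐ[brownianBridgeLaw] ∇ F}

/-- The Sobolev space `W^{1,2}(L; μ^{BB})`, the domain of the closure of the gradient form
`(F, G) ↦ ½ ∫ (∇F, ∇G) dμ^{BB}` on `exp(L)`. -/
def sobolevW12 : Set (Lp ℝ 2 brownianBridgeLaw) := {u | ∃ v, HasWeakGradient u v}

open Classical in
/-- The weak gradient of `u ∈ W^{1,2}(L; μ^{BB})` (and `0` for other `u`). -/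
noncomputable def weakGradient (u : Lp ℝ 2 brownianBridgeLaw) : Lp L01 2 brownianBridgeLaw :=
  if h : ∃ v, HasWeakGradient u v then h.choose else 0

/-- The norm of `W^{1,2}(L; μ^{BB})`. -/
noncomputable def sobolevNorm (u : Lp ℝ 2 brownianBridgeLaw) : ℝ :=
  √(‖u‖ ^ 2 + ‖weakGradient u‖ ^ 2)

/-!
The bridge covariance is the Green operator of `-d²/dt²` with Dirichlet boundary conditions, so its
range contains the test functions on `(0, 1)`, which are dense. Gaussian integration by parts in
these directions shows that if `(0, v)` is a limit of pairs `(F, ∇F)`, then `⟪v, R⟫` is orthogonal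
to all trigonometric functions for every test function `R`; hence `v = 0` by injectivity of the
Fourier transform of measures, and the gradient is closable.

For any finite measure, a `C¹` function that is bounded together with its gradient has its gradient
as weak gradient. In finite dimensions, Fourier inversion writes a compactly supported smooth
function and its gradient as an integral of trigonometric functions and their gradients, so a
continuous functional vanishing on the latter vanishes on the former; mollification and cut-off
give the `C¹` case, and composition with finite-dimensional orthogonal projections the infinite
dimensional one. Applied to `f ↦ F (φ_ε ∘ f)` with `φ_ε x = √(x² + ε²) - ε` and `ε → 0`, this gives
the gradient of `f ↦ F |f|`: the derivatives `φ_ε'` converge pointwise, and also at `0`, to the sign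
function.

Density of `exp(C^∞)` holds because `cos (⟪ξ, ·⟫ + α)` and its gradient depend continuously on `ξ`
in `L²`.
-/

section TrigonometricMoments

variable {E : Type*} [NormedAddCommGroup E] [InnerProductSpace ℝ E] [MeasurableSpace E]
  [BorelSpace E] [SecondCountableTopology E] {μ : Measure E}

theorem memLp_cos_inner_add [IsFiniteMeasure μ] (ξ : E) (α : ℝ) (p : ℝ≥0∞) :
    MemLp (fun x => Real.cos (⟪ξ, x⟫ + α)) p μ :=
  .of_bound (by fun_prop) 1 (ae_of_all _ fun _ => by simpa using Real.abs_cos_le_one _)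

theorem memLp_sin_inner_add [IsFiniteMeasure μ] (ξ : E) (α : ℝ) (p : ℝ≥0∞) :
    MemLp (fun x => Real.sin (⟪ξ, x⟫ + α)) p μ :=
  .of_bound (by fun_prop) 1 (ae_of_all _ fun _ => by simpa using Real.abs_sin_le_one _)

theorem integrable_mul_cos_inner_add {w : E → ℝ} (hw : Integrable w μ) (ξ : E) (α : ℝ) :
    Integrable (fun x => w x * Real.cos (⟪ξ, x⟫ + α)) μ :=
  hw.mul_bdd (c := 1) (by fun_prop) (ae_of_all _ fun _ => by simpa using Real.abs_cos_le_one _)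

theorem integral_mul_cexp_inner_eq_zero {w : E → ℝ} (hw : Integrable w μ)
    (h : ∀ (ξ : E) (α : ℝ), ∫ x, w x * Real.cos (⟪ξ, x⟫ + α) ∂μ = 0) (ξ : E) :
    ∫ x, w x * Complex.exp (⟪x, ξ⟫ * Complex.I) ∂μ = 0 := by
  have hexp (x : E) : (w x : ℂ) * Complex.exp (⟪x, ξ⟫ * Complex.I) =
      (w x * Real.cos (⟪ξ, x⟫ + 0) : ℝ) +
        (w x * Real.cos (⟪ξ, x⟫ + -(Real.pi / 2)) : ℝ) * Complex.I := by
    rw [real_inner_comm, Complex.exp_mul_I, ← sub_eq_add_neg, Real.cos_sub_pi_div_two]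
    push_cast
    ring_nf
  simp_rw [hexp]
  rw [integral_add (integrable_mul_cos_inner_add hw ξ _).ofReal
    ((integrable_mul_cos_inner_add hw ξ _).ofReal.mul_const _), integral_mul_const,
    integral_complex_ofReal, integral_complex_ofReal, h, h]
  simp

theorem ae_eq_zero_of_integral_mul_cos_inner_eq_zero [CompleteSpace E] {w : E → ℝ}
    (hw : Integrable w μ)
    (h : ∀ (ξ : E) (α : ℝ), ∫ x, w x * Real.cos (⟪ξ, x⟫ + α) ∂μ = 0) : w =ᵐ[μ] 0 := by
  have hpos : AEMeasurable (fun x => ENNReal.ofReal (w x)) μ := hw.1.aemeasurable.ennreal_ofReal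
  have hneg : AEMeasurable (fun x => ENNReal.ofReal (-w x)) μ :=
    hw.1.aemeasurable.neg.ennreal_ofReal
  have := isFiniteMeasure_withDensity hw.lintegral_lt_top.ne
  have := isFiniteMeasure_withDensity hw.neg.lintegral_lt_top.ne
  have hexp (v : E → ℝ) (hv : Integrable v μ) (ξ : E) :
      Integrable (fun x => v x • Complex.exp (⟪x, ξ⟫ * Complex.I)) μ := by
    simp only [Complex.real_smul]
    exact (hv.ofReal (𝕜 := ℂ)).mul_bdd (c := 1) (by fun_prop)
      (ae_of_all _ fun x => (Complex.norm_exp_ofReal_mul_I _).le)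
  have hchar : μ.withDensity (fun x => ENNReal.ofReal (w x)) =
      μ.withDensity (fun x => ENNReal.ofReal (-w x)) := by
    refine Measure.ext_of_charFun (funext fun ξ => ?_)
    rw [charFun_apply, charFun_apply,
      integral_withDensity_eq_integral_toReal_smul₀ hpos (ae_of_all _ fun _ => by simp),
      integral_withDensity_eq_integral_toReal_smul₀ hneg (ae_of_all _ fun _ => by simp),
      ← sub_eq_zero, ← integral_sub]
    · simp_rw [← sub_smul, ENNReal.toReal_ofReal', max_zero_sub_max_neg_zero_eq_self,
        Complex.real_smul]
      exact integral_mul_cexp_inner_eq_zero hw h ξ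
    · exact hexp _ (by simpa [ENNReal.toReal_ofReal'] using hw.pos_part) ξ
    · exact hexp _ (by simpa [ENNReal.toReal_ofReal'] using hw.neg_part) ξ
  filter_upwards [(withDensity_eq_iff hpos hneg hw.lintegral_lt_top.ne).1 hchar] with x hx
  have hx' := congrArg ENNReal.toReal hx
  rw [ENNReal.toReal_ofReal', ENNReal.toReal_ofReal', ← sub_eq_zero,
    max_zero_sub_max_neg_zero_eq_self] at hx'
  exact hx'

end TrigonometricMoments

section GaussianIntegrationByParts

variable {E : Type*} [NormedAddCommGroup E] [InnerProductSpace ℝ E] [MeasurableSpace E]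
  [BorelSpace E]

theorem hasDerivAt_exp_neg_covarianceBilin (μ : Measure E) (ξ η : E) :
    HasDerivAt (fun s : ℝ => Real.exp (-covarianceBilin μ (ξ + s • η) (ξ + s • η) / 2))
      (-covarianceBilin μ ξ η * Real.exp (-covarianceBilin μ ξ ξ / 2)) 0 := by
  have hline : HasDerivAt (fun s : ℝ => ξ + s • η) η 0 := by
    simpa using ((hasDerivAt_id (0 : ℝ)).smul_const η).const_add ξ
  have hquad := (covarianceBilin μ).hasFDerivAt_of_bilinear hline.hasFDerivAt hline.hasFDerivAt
  refine (hquad.hasDerivAt.neg.div_const 2).exp.congr_deriv ?_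
  simp [covarianceBilin_comm η ξ]
  ring

variable {μ : Measure E} [IsGaussian μ]

theorem memLp_inner_of_isGaussian (η : E) : MemLp (fun x => ⟪η, x⟫) 2 μ :=
  IsGaussian.memLp_dual μ (innerSL ℝ η) 2 (by simp)

theorem integrable_inner_of_isGaussian (η : E) : Integrable (fun x => ⟪η, x⟫) μ :=
  (memLp_inner_of_isGaussian η).integrable (by norm_num)

variable [CompleteSpace E] [SecondCountableTopology E]

theorem integral_sin_inner_add (h0 : ∫ x, x ∂μ = 0) (ξ : E) (α : ℝ) :
    ∫ x, Real.sin (⟪ξ, x⟫ + α) ∂μ = Real.sin α * Real.exp (-covarianceBilin μ ξ ξ / 2) := by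
  have hchar : ∫ x, Complex.exp (⟪x, ξ⟫ * Complex.I) ∂μ =
      (Real.exp (-covarianceBilin μ ξ ξ / 2) : ℝ) := by
    rw [← charFun_apply, IsGaussian.charFun_eq' ξ, show ∫ x, id x ∂μ = 0 from h0]
    simp [neg_div]
  have hsin (x : E) : Real.sin (⟪ξ, x⟫ + α) =
      (Complex.exp (⟪x, ξ⟫ * Complex.I) * Complex.exp (α * Complex.I)).im := by
    rw [← Complex.exp_add, ← add_mul, ← Complex.ofReal_add, Complex.exp_ofReal_mul_I_im,
      real_inner_comm]
  have hint : Integrable (fun x => Complex.exp (⟪x, ξ⟫ * Complex.I)) μ :=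
    .of_bound (by fun_prop) 1 (ae_of_all _ fun x => (Complex.norm_exp_ofReal_mul_I _).le)
  simp_rw [hsin, ← RCLike.im_eq_complex_im]
  rw [integral_im (hint.mul_const _), integral_mul_const, hchar, RCLike.im_eq_complex_im,
    Complex.im_ofReal_mul, Complex.exp_ofReal_mul_I_im, mul_comm]

theorem integral_inner_mul_cos (h0 : ∫ x, x ∂μ = 0) (ξ η : E) (α : ℝ) :
    ∫ x, ⟪η, x⟫ * Real.cos (⟪ξ, x⟫ + α) ∂μ =
      -covarianceBilin μ ξ η * ∫ x, Real.sin (⟪ξ, x⟫ + α) ∂μ := by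
  have hderiv (x : E) (s : ℝ) : HasDerivAt (fun s : ℝ => Real.sin (⟪ξ + s • η, x⟫ + α))
      (⟪η, x⟫ * Real.cos (⟪ξ + s • η, x⟫ + α)) s := by
    simp only [inner_add_left, real_inner_smul_left]
    simpa [mul_comm] using
      ((((hasDerivAt_id s).mul_const ⟪η, x⟫).const_add ⟪ξ, x⟫).add_const α).sin
  have hbound (x : E) (s : ℝ) : ‖⟪η, x⟫ * Real.cos (⟪ξ + s • η, x⟫ + α)‖ ≤ ‖⟪η, x⟫‖ := by
    rw [norm_mul]
    exact mul_le_of_le_one_right (norm_nonneg _) (by simpa using Real.abs_cos_le_one _)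
  have hint (ζ : E) : Integrable (fun x => Real.sin (⟪ζ, x⟫ + α)) μ :=
    (memLp_sin_inner_add ζ α 1).integrable le_rfl
  have hmoment := (hasDerivAt_integral_of_dominated_loc_of_deriv_le (μ := μ) (x₀ := (0 : ℝ))
    (F := fun s x => Real.sin (⟪ξ + s • η, x⟫ + α))
    (F' := fun s x => ⟪η, x⟫ * Real.cos (⟪ξ + s • η, x⟫ + α)) univ_mem
    (.of_forall fun s => (hint _).1) (hint _)
    (integrable_mul_cos_inner_add (integrable_inner_of_isGaussian η) _ α).1
    (ae_of_all _ fun x s _ => hbound x s) (integrable_inner_of_isGaussian η).norm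
    (ae_of_all _ fun x s _ => hderiv x s)).2
  simp only [zero_smul, add_zero] at hmoment
  refine hmoment.unique ?_
  simp_rw [integral_sin_inner_add h0]
  exact ((hasDerivAt_exp_neg_covarianceBilin μ ξ η).const_mul (Real.sin α)).congr_deriv (by ring)

theorem integral_inner_mul_cos_mul_cos (h0 : ∫ x, x ∂μ = 0) (ξ ζ η : E) (α β : ℝ) :
    ∫ x, ⟪η, x⟫ * (Real.cos (⟪ξ, x⟫ + α) * Real.cos (⟪ζ, x⟫ + β)) ∂μ =
      -covarianceBilin μ ξ η * (∫ x, Real.sin (⟪ξ, x⟫ + α) * Real.cos (⟪ζ, x⟫ + β) ∂μ) -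
        covarianceBilin μ ζ η * ∫ x, Real.cos (⟪ξ, x⟫ + α) * Real.sin (⟪ζ, x⟫ + β) ∂μ := by
  have hadd (x : E) : ⟪ξ + ζ, x⟫ + (α + β) = (⟪ξ, x⟫ + α) + (⟪ζ, x⟫ + β) := by
    rw [inner_add_left]; ring
  have hsub (x : E) : ⟪ξ - ζ, x⟫ + (α - β) = (⟪ξ, x⟫ + α) - (⟪ζ, x⟫ + β) := by
    rw [inner_sub_left]; ring
  have hη (θ : E) (γ : ℝ) := integrable_mul_cos_inner_add
    (integrable_inner_of_isGaussian (μ := μ) η) θ γ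
  have hsc : Integrable (fun x => Real.sin (⟪ξ, x⟫ + α) * Real.cos (⟪ζ, x⟫ + β)) μ :=
    integrable_mul_cos_inner_add ((memLp_sin_inner_add ξ α 1).integrable le_rfl) ζ β
  have hcs : Integrable (fun x => Real.cos (⟪ξ, x⟫ + α) * Real.sin (⟪ζ, x⟫ + β)) μ := by
    simpa only [mul_comm] using
      integrable_mul_cos_inner_add ((memLp_sin_inner_add ζ β 1).integrable le_rfl) ξ α
  calc
    _ = (1 / 2) * ((∫ x, ⟪η, x⟫ * Real.cos (⟪ξ + ζ, x⟫ + (α + β)) ∂μ) +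
          ∫ x, ⟪η, x⟫ * Real.cos (⟪ξ - ζ, x⟫ + (α - β)) ∂μ) := by
      rw [← integral_add (hη _ _) (hη _ _), ← integral_const_mul]
      congr with x
      rw [hadd, hsub, Real.cos_add (⟪ξ, x⟫ + α), Real.cos_sub]
      ring
    _ = _ := by
      rw [integral_inner_mul_cos h0, integral_inner_mul_cos h0]
      simp_rw [hadd, hsub, Real.sin_add (⟪ξ, _⟫ + α), Real.sin_sub]
      rw [integral_add hsc hcs, integral_sub hsc hcs]
      simp only [map_add, map_sub, add_apply, sub_apply]
      ring

end GaussianIntegrationByParts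

section DominatedConvergence

variable {Ω E : Type*} [MeasurableSpace Ω] [NormedAddCommGroup E] {μ : Measure Ω} {p : ℝ≥0∞}

theorem tendsto_Lp_of_dominated [Fact (1 ≤ p)] (hp : p ≠ ∞) {U : ℕ → Lp E p μ} {u : Lp E p μ}
    {b : Ω → ℝ} (hb : MemLp b p μ) (hbound : ∀ n, ∀ᵐ ω ∂μ, ‖U n ω‖ ≤ b ω)
    (hlim : ∀ᵐ ω ∂μ, Tendsto (fun n => U n ω) atTop (𝓝 (u ω))) : Tendsto U atTop (𝓝 u) := by
  have hp0 : p ≠ 0 := (zero_lt_one.trans_le Fact.out).ne'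
  have hr : 0 < p.toReal := ENNReal.toReal_pos hp0 hp
  rw [Lp.tendsto_Lp_iff_tendsto_eLpNorm']
  simp_rw [eLpNorm_eq_lintegral_rpow_enorm_toReal hp0 hp]
  suffices Tendsto (fun n => ∫⁻ ω, ‖(⇑(U n) - ⇑u) ω‖ₑ ^ p.toReal ∂μ) atTop (𝓝 0) by
    simpa [hr] using this.ennrpow_const (1 / p.toReal)
  have hdom (n : ℕ) : ∀ᵐ ω ∂μ, ‖(⇑(U n) - ⇑u) ω‖ₑ ^ p.toReal ≤ ‖2 * b ω‖ₑ ^ p.toReal := by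
    filter_upwards [ae_all_iff.2 hbound, hlim] with ω hω hω'
    have hu : ‖u ω‖ ≤ b ω := le_of_tendsto hω'.norm (.of_forall hω)
    gcongr
    rw [enorm_le_iff_norm_le, Pi.sub_apply]
    calc ‖U n ω - u ω‖ ≤ ‖U n ω‖ + ‖u ω‖ := norm_sub_le _ _
      _ ≤ 2 * b ω := by linarith [hω n]
      _ ≤ ‖2 * b ω‖ := Real.le_norm_self _
  have h0 := tendsto_lintegral_of_dominated_convergence' _
    (fun n => ((Lp.aestronglyMeasurable (U n)).sub (Lp.aestronglyMeasurable u)).enorm.pow_const _)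
    hdom (lintegral_rpow_enorm_lt_top_of_eLpNorm_lt_top hp0 hp (hb.const_mul 2).2).ne
    (f := fun _ => 0) ?_
  · simpa using h0
  · filter_upwards [hlim] with ω hω
    have hsub : Tendsto (fun n => ‖U n ω - u ω‖ₑ) atTop (𝓝 0) := by
      simpa using (hω.sub_const (u ω)).enorm
    simpa [hr] using hsub.ennrpow_const p.toReal

theorem inner_toLp_left [InnerProductSpace ℝ E] {w : Ω → E} (hw : MemLp w 2 μ) (v : Lp E 2 μ) :
    ⟪hw.toLp, v⟫ = ∫ ω, ⟪w ω, v ω⟫ ∂μ := by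
  rw [L2.inner_def]
  refine integral_congr_ae ?_
  filter_upwards [hw.coeFn_toLp] with ω hω
  rw [hω]

end DominatedConvergence

section WeakGradientGraph

variable {E : Type*} [NormedAddCommGroup E] [InnerProductSpace ℝ E] [MeasurableSpace E]
  [BorelSpace E] [SecondCountableTopology E]

theorem memLp_neg_sin_inner_add_smul {μ : Measure E} [IsFiniteMeasure μ] (ξ : E) (α : ℝ)
    (p : ℝ≥0∞) : MemLp (fun x => -Real.sin (⟪ξ, x⟫ + α) • ξ) p μ :=
  .of_bound (by fun_prop) ‖ξ‖ (ae_of_all _ fun _ => by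
    rw [norm_smul, norm_neg]
    exact mul_le_of_le_one_left (norm_nonneg _) (Real.abs_sin_le_one _))

/-- The function `cos (⟪ξ, ·⟫ + α)` and its gradient, as a pair of `L²` classes. The phase `α`
allows for treating sines and cosines together. -/
noncomputable def cosPair (μ : Measure E) [IsFiniteMeasure μ] (ξ : E) (α : ℝ) :
    Lp ℝ 2 μ × Lp E 2 μ :=
  ((memLp_cos_inner_add ξ α 2).toLp, (memLp_neg_sin_inner_add_smul ξ α 2).toLp)

/-- The graph, in `L²(μ) × L²(μ; E)`, of the gradient on trigonometric functions with frequencies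
in `S`. -/
noncomputable def trigGraph (μ : Measure E) [IsFiniteMeasure μ] (S : Set E) :
    Submodule ℝ (Lp ℝ 2 μ × Lp E 2 μ) :=
  Submodule.span ℝ {p | ∃ ξ ∈ S, ∃ α, p = cosPair μ ξ α}

/-- The graph of the weak gradient for `μ`, that is, of the closure of the gradient on
trigonometric functions. -/
noncomputable def weakGradientGraph (μ : Measure E) [IsFiniteMeasure μ] :
    Submodule ℝ (Lp ℝ 2 μ × Lp E 2 μ) :=
  (trigGraph μ Set.univ).topologicalClosure

variable {μ : Measure E} [IsFiniteMeasure μ]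

theorem cosPair_mem_trigGraph {S : Set E} {ξ : E} (hξ : ξ ∈ S) (α : ℝ) :
    cosPair μ ξ α ∈ trigGraph μ S := Submodule.subset_span ⟨ξ, hξ, α, rfl⟩

theorem trigGraph_le_weakGradientGraph (S : Set E) : trigGraph μ S ≤ weakGradientGraph μ :=
  le_trans (Submodule.span_mono (by rintro _ ⟨ξ, -, α, rfl⟩; exact ⟨ξ, trivial, α, rfl⟩))
    (Submodule.le_topologicalClosure _)

theorem continuous_cosPair (α : ℝ) : Continuous fun ξ => cosPair μ ξ α := by
  refine continuous_iff_seqContinuous.2 fun x ξ hx => ?_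
  have hphase (y : E) : Tendsto (fun n => ⟪x n, y⟫ + α) atTop (𝓝 (⟪ξ, y⟫ + α)) :=
    (hx.inner tendsto_const_nhds).add_const α
  obtain ⟨C, hC⟩ := hx.norm.bddAbove_range
  have hC' (n : ℕ) : ‖x n‖ ≤ C := hC ⟨n, rfl⟩
  have hfst (ζ : E) := (memLp_cos_inner_add (μ := μ) ζ α 2).coeFn_toLp
  have hsnd (ζ : E) := (memLp_neg_sin_inner_add_smul (μ := μ) ζ α 2).coeFn_toLp
  refine Tendsto.prodMk_nhds
    (tendsto_Lp_of_dominated ENNReal.ofNat_ne_top (memLp_const (1 : ℝ)) (fun n => ?_) ?_)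
    (tendsto_Lp_of_dominated ENNReal.ofNat_ne_top (memLp_const C) (fun n => ?_) ?_)
  · filter_upwards [hfst (x n)] with y hy
    simpa [cosPair, hy] using Real.abs_cos_le_one _
  · filter_upwards [ae_all_iff.2 fun n => hfst (x n), hfst ξ] with y hy hy'
    simpa only [cosPair, hy, hy', Function.comp_def] using
      (Real.continuous_cos.tendsto _).comp (hphase y)
  · filter_upwards [hsnd (x n)] with y hy
    simp only [hy, norm_smul, norm_neg]
    exact (mul_le_of_le_one_left (norm_nonneg _) (Real.abs_sin_le_one _)).trans (hC' n)
  · filter_upwards [ae_all_iff.2 fun n => hsnd (x n), hsnd ξ] with y hy hy'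
    simpa only [cosPair, Function.comp_apply, hy, hy'] using
      ((Real.continuous_sin.tendsto _).comp (hphase y)).neg.smul hx

theorem topologicalClosure_trigGraph_of_dense {S : Set E} (hS : Dense S) :
    (trigGraph μ S).topologicalClosure = weakGradientGraph μ := by
  refine le_antisymm (Submodule.topologicalClosure_minimal _ (trigGraph_le_weakGradientGraph S)
    (Submodule.isClosed_topologicalClosure _)) ?_
  refine Submodule.topologicalClosure_minimal _ (Submodule.span_le.2 ?_)
    (Submodule.isClosed_topologicalClosure _)
  rintro _ ⟨ξ, -, α, rfl⟩
  exact map_mem_closure (f := fun ζ => cosPair μ ζ α) (continuous_cosPair α) (hS ξ)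
    fun ζ hζ => cosPair_mem_trigGraph hζ α

theorem inner_eq_inner_of_mem_weakGradientGraph {a : Lp ℝ 2 μ} {b : Lp E 2 μ}
    (hcos : ∀ ξ α, ⟪b, (cosPair μ ξ α).2⟫ = ⟪a, (cosPair μ ξ α).1⟫) {u : Lp ℝ 2 μ} {v : Lp E 2 μ}
    (huv : (u, v) ∈ weakGradientGraph μ) : ⟪b, v⟫ = ⟪a, u⟫ := by
  let Φ : Lp ℝ 2 μ × Lp E 2 μ →L[ℝ] ℝ := innerSL ℝ b ∘L .snd ℝ _ _
  let Ψ : Lp ℝ 2 μ × Lp E 2 μ →L[ℝ] ℝ := innerSL ℝ a ∘L .fst ℝ _ _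
  have hle : weakGradientGraph μ ≤ LinearMap.eqLocus Φ.toLinearMap Ψ.toLinearMap := by
    refine Submodule.topologicalClosure_minimal _ (Submodule.span_le.2 ?_)
      (isClosed_eq Φ.continuous Ψ.continuous)
    rintro _ ⟨ξ, -, α, rfl⟩
    exact hcos ξ α
  exact hle huv

end WeakGradientGraph

section Closability

variable {E : Type*} [NormedAddCommGroup E] [InnerProductSpace ℝ E] [CompleteSpace E]
  [MeasurableSpace E] [BorelSpace E] [SecondCountableTopology E] {μ : Measure E} [IsGaussian μ]

theorem integral_inner_neg_sin_smul_mul_cos (h0 : ∫ x, x ∂μ = 0) {η R : E}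
    (hR : ∀ ξ, covarianceBilin μ ξ η = ⟪ξ, R⟫) (ξ ζ : E) (α β : ℝ) :
    ∫ x, ⟪-Real.sin (⟪ξ, x⟫ + α) • ξ, R⟫ * Real.cos (⟪ζ, x⟫ + β) ∂μ =
      ∫ x, Real.cos (⟪ξ, x⟫ + α) *
        (⟪η, x⟫ * Real.cos (⟪ζ, x⟫ + β) + ⟪ζ, R⟫ * Real.sin (⟪ζ, x⟫ + β)) ∂μ := by
  have hcc : Integrable
      (fun x => ⟪η, x⟫ * (Real.cos (⟪ξ, x⟫ + α) * Real.cos (⟪ζ, x⟫ + β))) μ := by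
    simpa only [mul_assoc] using integrable_mul_cos_inner_add
      (integrable_mul_cos_inner_add (integrable_inner_of_isGaussian η) ξ α) ζ β
  have hcs : Integrable (fun x => Real.cos (⟪ξ, x⟫ + α) * Real.sin (⟪ζ, x⟫ + β)) μ := by
    simpa only [mul_comm] using
      integrable_mul_cos_inner_add ((memLp_sin_inner_add ζ β 1).integrable le_rfl) ξ α
  calc
    _ = -⟪ξ, R⟫ * ∫ x, Real.sin (⟪ξ, x⟫ + α) * Real.cos (⟪ζ, x⟫ + β) ∂μ := by
      rw [← integral_const_mul]
      congr with x
      rw [real_inner_smul_left]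
      ring
    _ = (∫ x, ⟪η, x⟫ * (Real.cos (⟪ξ, x⟫ + α) * Real.cos (⟪ζ, x⟫ + β)) ∂μ) +
        ⟪ζ, R⟫ * ∫ x, Real.cos (⟪ξ, x⟫ + α) * Real.sin (⟪ζ, x⟫ + β) ∂μ := by
      rw [integral_inner_mul_cos_mul_cos h0, hR, hR]
      ring
    _ = _ := by
      rw [← integral_const_mul, ← integral_add hcc (hcs.const_mul _)]
      congr with x
      ring

theorem integral_by_parts_of_mem_weakGradientGraph (h0 : ∫ x, x ∂μ = 0) {η R : E}
    (hR : ∀ ξ, covarianceBilin μ ξ η = ⟪ξ, R⟫) {u : Lp ℝ 2 μ} {v : Lp E 2 μ}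
    (huv : (u, v) ∈ weakGradientGraph μ) (ζ : E) (β : ℝ) :
    ∫ x, ⟪v x, R⟫ * Real.cos (⟪ζ, x⟫ + β) ∂μ =
      ∫ x, u x * (⟪η, x⟫ * Real.cos (⟪ζ, x⟫ + β) + ⟪ζ, R⟫ * Real.sin (⟪ζ, x⟫ + β)) ∂μ := by
  have hcos : MemLp (fun x => Real.cos (⟪ζ, x⟫ + β) • R) 2 μ :=
    .of_bound (by fun_prop) ‖R‖ (ae_of_all _ fun x => by
      rw [norm_smul]
      exact mul_le_of_le_one_left (norm_nonneg _) (Real.abs_cos_le_one _))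
  have hηcos : MemLp (fun x => ⟪η, x⟫ * Real.cos (⟪ζ, x⟫ + β)) 2 μ :=
    (memLp_inner_of_isGaussian η).mono (by fun_prop) (ae_of_all _ fun x => by
      rw [norm_mul]
      exact mul_le_of_le_one_right (norm_nonneg _) (Real.abs_cos_le_one _))
  have hdiv : MemLp (fun x => ⟪η, x⟫ * Real.cos (⟪ζ, x⟫ + β) +
      ⟪ζ, R⟫ * Real.sin (⟪ζ, x⟫ + β)) 2 μ :=
    hηcos.add ((memLp_sin_inner_add ζ β 2).const_mul ⟪ζ, R⟫)
  have hv (v : Lp E 2 μ) :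
      ∫ x, ⟪v x, R⟫ * Real.cos (⟪ζ, x⟫ + β) ∂μ = ⟪hcos.toLp, v⟫ := by
    rw [inner_toLp_left]
    congr with x
    rw [real_inner_smul_left, real_inner_comm, mul_comm]
  have hu (u : Lp ℝ 2 μ) : ∫ x, u x * (⟪η, x⟫ * Real.cos (⟪ζ, x⟫ + β) +
      ⟪ζ, R⟫ * Real.sin (⟪ζ, x⟫ + β)) ∂μ = ⟪hdiv.toLp, u⟫ := by
    rw [inner_toLp_left]
    rfl
  rw [hu, hv]
  refine inner_eq_inner_of_mem_weakGradientGraph (fun ξ α => ?_) huv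
  rw [← hu, ← hv]
  refine Eq.trans (integral_congr_ae ?_)
    ((integral_inner_neg_sin_smul_mul_cos h0 hR ξ ζ α β).trans (integral_congr_ae ?_))
  · filter_upwards [(memLp_neg_sin_inner_add_smul (μ := μ) ξ α 2).coeFn_toLp] with x hx
    simp only [cosPair, hx]
  · filter_upwards [(memLp_cos_inner_add (μ := μ) ξ α 2).coeFn_toLp] with x hx
    simp only [cosPair, hx]

theorem eq_of_mem_weakGradientGraph (h0 : ∫ x, x ∂μ = 0)
    (hdense : Dense {R : E | ∃ η, ∀ ξ, covarianceBilin μ ξ η = ⟪ξ, R⟫})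
    {u : Lp ℝ 2 μ} {v v' : Lp E 2 μ} (hv : (u, v) ∈ weakGradientGraph μ)
    (hv' : (u, v') ∈ weakGradientGraph μ) : v = v' := by
  have hsub : ((0 : Lp ℝ 2 μ), v - v') ∈ weakGradientGraph μ := by
    simpa using sub_mem hv hv'
  have horth : ∀ R ∈ {R : E | ∃ η, ∀ ξ, covarianceBilin μ ξ η = ⟪ξ, R⟫},
      ∀ᵐ x ∂μ, ⟪(v - v') x, R⟫ = 0 := by
    rintro R ⟨η, hR⟩
    refine ae_eq_zero_of_integral_mul_cos_inner_eq_zero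
      (((Lp.memLp (v - v')).inner_const R).integrable (by norm_num)) fun ζ β => ?_
    rw [integral_by_parts_of_mem_weakGradientGraph h0 hR hsub]
    refine integral_eq_zero_of_ae ?_
    filter_upwards [Lp.coeFn_zero ℝ 2 μ] with x hx
    rw [hx, Pi.zero_apply, zero_mul]
  obtain ⟨D, hD, hDc, hDd⟩ := hdense.exists_countable_dense_subset
  rw [← sub_eq_zero]
  refine Lp.ext ?_
  filter_upwards [(ae_ball_iff hDc).2 fun R hR => horth R (hD hR), Lp.coeFn_zero E 2 μ] with x hx h0
  rw [h0]
  exact hDd.eq_zero_of_inner_left ℝ hx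

end Closability

section Annihilator

theorem mem_topologicalClosure_of_forall_inner_add_inner {H₁ H₂ : Type*} [NormedAddCommGroup H₁]
    [InnerProductSpace ℝ H₁] [CompleteSpace H₁] [NormedAddCommGroup H₂] [InnerProductSpace ℝ H₂]
    [CompleteSpace H₂] {K : Submodule ℝ (H₁ × H₂)} {p : H₁ × H₂}
    (h : ∀ a b, (∀ q ∈ K, ⟪a, q.1⟫ + ⟪b, q.2⟫ = 0) → ⟪a, p.1⟫ + ⟪b, p.2⟫ = 0) :
    p ∈ K.topologicalClosure := by
  let e := (WithLp.prodContinuousLinearEquiv 2 ℝ H₁ H₂).symm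
  have hmem : e p ∈ (K.map e.toLinearMap).topologicalClosure := by
    rw [← Submodule.orthogonal_orthogonal_eq_closure, Submodule.mem_orthogonal]
    intro c hc
    rw [WithLp.prod_inner_apply]
    refine h c.fst c.snd fun q hq => ?_
    rw [Submodule.mem_orthogonal'] at hc
    exact (WithLp.prod_inner_apply c (e q)).symm.trans (hc _ (Submodule.mem_map_of_mem hq))
  have hcl : e p ∈ closure (e '' K) := hmem
  rwa [← e.image_closure, e.injective.mem_set_image] at hcl

theorem inner_add_inner_toLp {E : Type*} [NormedAddCommGroup E] [InnerProductSpace ℝ E]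
    [MeasurableSpace E] {μ : Measure E} {u : E → ℝ} {v : E → E} (hu : MemLp u 2 μ)
    (hv : MemLp v 2 μ) (a : Lp ℝ 2 μ) (b : Lp E 2 μ) :
    ⟪a, hu.toLp⟫ + ⟪b, hv.toLp⟫ = ∫ x, (a x * u x + ⟪b x, v x⟫) ∂μ := by
  rw [L2.inner_def, L2.inner_def,
    ← integral_add (L2.integrable_inner _ _) (L2.integrable_inner _ _)]
  refine integral_congr_ae ?_
  filter_upwards [hu.coeFn_toLp, hv.coeFn_toLp] with x hux hvx
  rw [hux, hvx, Real.inner_apply]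

end Annihilator

section IsWeakGradient

variable {E : Type*} [NormedAddCommGroup E] [InnerProductSpace ℝ E] [MeasurableSpace E]
  [BorelSpace E] [SecondCountableTopology E] {μ : Measure E} [IsFiniteMeasure μ]

/-- The vector field `v` represents the weak gradient of the function `u`. -/
def IsWeakGradient (μ : Measure E) [IsFiniteMeasure μ] (u : E → ℝ) (v : E → E) : Prop :=
  ∃ (hu : MemLp u 2 μ) (hv : MemLp v 2 μ), (hu.toLp, hv.toLp) ∈ weakGradientGraph μ

theorem IsWeakGradient.of_tendsto {U : ℕ → E → ℝ} {V : ℕ → E → E} {u : E → ℝ} {v : E → E}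
    (h : ∀ n, IsWeakGradient μ (U n) (V n)) {C D : ℝ} (hU : ∀ n x, ‖U n x‖ ≤ C)
    (hV : ∀ n x, ‖V n x‖ ≤ D) (hu : ∀ x, Tendsto (fun n => U n x) atTop (𝓝 (u x)))
    (hv : ∀ x, Tendsto (fun n => V n x) atTop (𝓝 (v x))) : IsWeakGradient μ u v := by
  choose hUm hVm hmem using h
  have hum : MemLp u 2 μ := .of_bound
    (aestronglyMeasurable_of_tendsto_ae atTop (fun n => (hUm n).1) (ae_of_all _ hu)) C
    (ae_of_all _ fun x => le_of_tendsto (hu x).norm (.of_forall fun n => hU n x))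
  have hvm : MemLp v 2 μ := .of_bound
    (aestronglyMeasurable_of_tendsto_ae atTop (fun n => (hVm n).1) (ae_of_all _ hv)) D
    (ae_of_all _ fun x => le_of_tendsto (hv x).norm (.of_forall fun n => hV n x))
  refine ⟨hum, hvm, (Submodule.isClosed_topologicalClosure _).mem_of_tendsto
    (b := atTop) (Tendsto.prodMk_nhds ?_ ?_) (.of_forall hmem)⟩
  · refine tendsto_Lp_of_dominated ENNReal.ofNat_ne_top (memLp_const C) (fun n => ?_) ?_
    · filter_upwards [(hUm n).coeFn_toLp] with x hx
      rw [hx]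
      exact hU n x
    · filter_upwards [ae_all_iff.2 fun n => (hUm n).coeFn_toLp, hum.coeFn_toLp] with x hx hx'
      simpa only [hx, hx'] using hu x
  · refine tendsto_Lp_of_dominated ENNReal.ofNat_ne_top (memLp_const D) (fun n => ?_) ?_
    · filter_upwards [(hVm n).coeFn_toLp] with x hx
      rw [hx]
      exact hV n x
    · filter_upwards [ae_all_iff.2 fun n => (hVm n).coeFn_toLp, hvm.coeFn_toLp] with x hx hx'
      simpa only [hx, hx'] using hv x

theorem isWeakGradient_of_forall_integral_eq_zero [CompleteSpace E] {u : E → ℝ} {v : E → E}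
    (hu : MemLp u 2 μ) (hv : MemLp v 2 μ)
    (h : ∀ (a : Lp ℝ 2 μ) (b : Lp E 2 μ),
      (∀ ξ α, ∫ x, (a x * Real.cos (⟪ξ, x⟫ + α) - ⟪b x, ξ⟫ * Real.sin (⟪ξ, x⟫ + α)) ∂μ = 0) →
      ∫ x, (a x * u x + ⟪b x, v x⟫) ∂μ = 0) : IsWeakGradient μ u v := by
  refine ⟨hu, hv, mem_topologicalClosure_of_forall_inner_add_inner fun a b hab => ?_⟩
  rw [inner_add_inner_toLp]
  refine h a b fun ξ α => ?_
  rw [← hab _ (cosPair_mem_trigGraph (Set.mem_univ ξ) α)]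
  unfold cosPair
  rw [inner_add_inner_toLp]
  congr with x
  rw [real_inner_smul_right]
  ring

theorem integral_add_inner_mul_cexp_eq_zero {a : Lp ℝ 2 μ} {b : Lp E 2 μ}
    (hab : ∀ ξ α,
      ∫ x, (a x * Real.cos (⟪ξ, x⟫ + α) - ⟪b x, ξ⟫ * Real.sin (⟪ξ, x⟫ + α)) ∂μ = 0) (ξ : E) :
    ∫ x, (a x + ⟪b x, ξ⟫ * Complex.I) * Complex.exp (⟪ξ, x⟫ * Complex.I) ∂μ = 0 := by
  have ha : Integrable a μ := (Lp.memLp a).integrable (by norm_num)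
  have hb : Integrable (fun x => ⟪b x, ξ⟫) μ :=
    ((Lp.memLp b).inner_const ξ).integrable (by norm_num)
  have hsin (α : ℝ) : Integrable (fun x => ⟪b x, ξ⟫ * Real.sin (⟪ξ, x⟫ + α)) μ :=
    hb.mul_bdd (c := 1) (by fun_prop) (ae_of_all _ fun x => Real.abs_sin_le_one _)
  have hint (α : ℝ) : Integrable
      (fun x => a x * Real.cos (⟪ξ, x⟫ + α) - ⟪b x, ξ⟫ * Real.sin (⟪ξ, x⟫ + α)) μ :=
    (integrable_mul_cos_inner_add ha ξ α).sub (hsin α)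
  have hsum : ∀ x, (a x + ⟪b x, ξ⟫ * Complex.I) * Complex.exp (⟪ξ, x⟫ * Complex.I) =
      (a x * Real.cos (⟪ξ, x⟫ + 0) - ⟪b x, ξ⟫ * Real.sin (⟪ξ, x⟫ + 0) : ℝ) +
        (a x * Real.cos (⟪ξ, x⟫ + -(Real.pi / 2)) -
          ⟪b x, ξ⟫ * Real.sin (⟪ξ, x⟫ + -(Real.pi / 2)) : ℝ) * Complex.I := fun x => by
    rw [← sub_eq_add_neg, Real.cos_sub_pi_div_two, Real.sin_sub_pi_div_two, Complex.exp_mul_I,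
      add_zero]
    push_cast
    linear_combination (⟪b x, ξ⟫ : ℂ) * Complex.sin (⟪ξ, x⟫ : ℝ) * Complex.I_sq
  simp_rw [hsum]
  rw [integral_add (hint 0).ofReal ((hint _).ofReal.mul_const _), integral_mul_const,
    integral_complex_ofReal, integral_complex_ofReal, hab, hab, Complex.ofReal_zero, zero_mul,
    add_zero]

end IsWeakGradient

section Pullback

variable {E V : Type*} [NormedAddCommGroup E] [InnerProductSpace ℝ E] [CompleteSpace E]
  [MeasurableSpace E] [BorelSpace E] [SecondCountableTopology E] [NormedAddCommGroup V]
  [InnerProductSpace ℝ V] [CompleteSpace V] [MeasurableSpace V] [BorelSpace V]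
  [SecondCountableTopology V] {μ : Measure E} [IsFiniteMeasure μ]

theorem compLpL_compMeasurePreserving_toLp {X Y F G : Type*} [MeasurableSpace X]
    [MeasurableSpace Y] [NormedAddCommGroup F] [NormedSpace ℝ F] [NormedAddCommGroup G]
    [NormedSpace ℝ G] {ν : Measure X} {ρ : Measure Y} {p : ℝ≥0∞} [Fact (1 ≤ p)] {T : X → Y}
    (hT : MeasurePreserving T ν ρ) (B : F →L[ℝ] G) {z : Y → F} (hz : MemLp z p ρ)
    (hz' : MemLp (fun x => B (z (T x))) p ν) :
    B.compLpL p ν (Lp.compMeasurePreserving T hT hz.toLp) = hz'.toLp := by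
  refine Lp.ext ?_
  filter_upwards [B.coeFn_compLpL (Lp.compMeasurePreserving T hT hz.toLp),
    Lp.coeFn_compMeasurePreserving hz.toLp hT, hT.quasiMeasurePreserving.ae hz.coeFn_toLp,
    hz'.coeFn_toLp] with x hcomp hpre hzx hzx'
  refine hcomp.trans ?_
  rw [hzx', hpre, Function.comp_apply, hzx]

theorem IsWeakGradient.comp_continuousLinearMap (A : E →L[ℝ] V) {u : V → ℝ} {v : V → V}
    (h : IsWeakGradient (μ.map A) u v) :
    IsWeakGradient μ (fun x => u (A x)) fun x => A.adjoint (v (A x)) := by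
  obtain ⟨hu, hv, huv⟩ := h
  have hA : MeasurePreserving A μ (μ.map A) := A.measurable.measurePreserving μ
  let Φ : Lp ℝ 2 (μ.map A) × Lp V 2 (μ.map A) →L[ℝ] Lp ℝ 2 μ × Lp E 2 μ :=
    (Lp.compMeasurePreservingₗᵢ ℝ A hA).toContinuousLinearMap.prodMap
      (A.adjoint.compLpL 2 μ ∘L (Lp.compMeasurePreservingₗᵢ ℝ A hA).toContinuousLinearMap)
  have hΦ {w : V → ℝ} {z : V → V} {w' : E → ℝ} {z' : E → E} (hw : MemLp w 2 (μ.map A))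
      (hz : MemLp z 2 (μ.map A)) (hw' : MemLp w' 2 μ) (hz' : MemLp z' 2 μ)
      (hww' : ∀ x, w' x = w (A x)) (hzz' : ∀ x, z' x = A.adjoint (z (A x))) :
      Φ (hw.toLp, hz.toLp) = (hw'.toLp, hz'.toLp) := by
    obtain rfl : w' = fun x => w (A x) := funext hww'
    obtain rfl : z' = fun x => A.adjoint (z (A x)) := funext hzz'
    exact Prod.ext rfl (compLpL_compMeasurePreserving_toLp hA A.adjoint hz hz')
  have hle : weakGradientGraph (μ.map A) ≤ (weakGradientGraph μ).comap Φ.toLinearMap := by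
    refine Submodule.topologicalClosure_minimal _ (Submodule.span_le.2 ?_)
      ((Submodule.isClosed_topologicalClosure _).preimage Φ.continuous)
    rintro _ ⟨ξ, -, α, rfl⟩
    have hcos : Φ (cosPair (μ.map A) ξ α) = cosPair μ (A.adjoint ξ) α :=
      hΦ _ _ _ _ (fun x => by rw [A.adjoint_inner_left]) fun x => by
        rw [map_smul, A.adjoint_inner_left]
    change Φ _ ∈ weakGradientGraph μ
    rw [hcos]
    exact trigGraph_le_weakGradientGraph _ (cosPair_mem_trigGraph (Set.mem_univ _) α)
  have huA : MemLp (fun x => u (A x)) 2 μ := hu.comp_measurePreserving hA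
  have hvA : MemLp (fun x => A.adjoint (v (A x))) 2 μ :=
    A.adjoint.comp_memLp' (hv.comp_measurePreserving hA)
  exact ⟨huA, hvA, hΦ hu hv huA hvA (fun _ => rfl) (fun _ => rfl) ▸ hle huv⟩

end Pullback

section FiniteDimensional

open scoped FourierTransform SchwartzMap LineDeriv

variable {V : Type*} [NormedAddCommGroup V] [InnerProductSpace ℝ V] [FiniteDimensional ℝ V]
  [MeasurableSpace V] [BorelSpace V]

theorem exists_fourier_representation {G : V → ℝ} (hG : ContDiff ℝ (⊤ : ℕ∞) G)
    (hc : HasCompactSupport G) : ∃ h : 𝓢(V, ℂ), ∀ (s : ℝ) (x m : V),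
      ∫ w, (s + ⟪m, (2 * Real.pi) • w⟫ * Complex.I) *
        Complex.exp (⟪(2 * Real.pi) • w, x⟫ * Complex.I) * h w = (s * G x + ⟪m, ∇ G x⟫ : ℝ) := by
  have hcC : HasCompactSupport fun x => (G x : ℂ) := hc.comp_left Complex.ofReal_zero
  let ψ : 𝓢(V, ℂ) := hcC.toSchwartzMap (Complex.ofRealCLM.contDiff.comp hG)
  refine ⟨𝓕 ψ, fun s x m => ?_⟩
  have hfd : HasFDerivAt ψ (Complex.ofRealCLM ∘L fderiv ℝ G x) x :=
    Complex.ofRealCLM.hasFDerivAt.comp x (hG.differentiable (by simp) x).hasFDerivAt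
  let θ : 𝓢(V, ℂ) := (s : ℂ) • ψ + ∂_{m} ψ
  have hθ : (s * G x + ⟪m, ∇ G x⟫ : ℝ) = θ x := by
    rw [add_apply, SchwartzMap.lineDerivOp_apply_eq_fderiv, hfd.fderiv,
      real_inner_comm, inner_gradient_left, Complex.ofReal_add, Complex.ofReal_mul]
    rfl
  have ht : (inner ℝ · m : V → ℝ).HasTemperateGrowth := by fun_prop
  have hθF (w : V) : 𝓕 θ w = (s + ⟪m, (2 * Real.pi) • w⟫ * Complex.I) * 𝓕 ψ w := by
    simp only [θ, FourierTransform.fourier_add, FourierTransform.fourier_smul,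
      SchwartzMap.fourier_lineDerivOp_eq, add_apply, smul_apply,
      SchwartzMap.smulLeftCLM_apply_apply ht, smul_eq_mul, Complex.real_smul,
      real_inner_smul_right, real_inner_comm w m]
    push_cast
    ring
  rw [hθ, ← FourierTransform.fourierInv_fourier_eq (F := 𝓢(V, ℂ)) θ, SchwartzMap.fourierInv_coe,
    Real.fourierInv_eq']
  refine integral_congr_ae (ae_of_all _ fun w => ?_)
  simp only [hθF, real_inner_smul_left, smul_eq_mul]
  ring

theorem integrable_prod_add_inner_mul_cexp_mul {μ : Measure V} {a : V → ℝ} {b : V → V}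
    (ha : Integrable a μ) (hb : Integrable b μ) (h : 𝓢(V, ℂ)) :
    Integrable (fun p : V × V => (a p.1 + ⟪b p.1, (2 * Real.pi) • p.2⟫ * Complex.I) *
      Complex.exp (⟪(2 * Real.pi) • p.2, p.1⟫ * Complex.I) * h p.2) (μ.prod volume) := by
  have hbound : Integrable (fun p : V × V =>
      ‖a p.1‖ * ‖h p.2‖ + (2 * Real.pi * ‖b p.1‖) * (‖p.2‖ ^ 1 * ‖h p.2‖)) (μ.prod volume) :=
    (ha.norm.mul_prod h.integrable.norm).add
      ((hb.norm.const_mul _).mul_prod (h.integrable_pow_mul volume 1))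
  have ham : AEStronglyMeasurable (fun p : V × V => (a p.1 : ℂ)) (μ.prod volume) :=
    Complex.continuous_ofReal.comp_aestronglyMeasurable ha.1.comp_fst
  have hbm : AEStronglyMeasurable (fun p : V × V => (⟪b p.1, (2 * Real.pi) • p.2⟫ : ℂ))
      (μ.prod volume) :=
    Complex.continuous_ofReal.comp_aestronglyMeasurable
      (hb.1.comp_fst.inner (by fun_prop : Continuous _).aestronglyMeasurable)
  have hcont : Continuous h := h.continuous
  refine hbound.mono (((ham.add (hbm.mul_const _)).mul
    (by fun_prop : Continuous _).aestronglyMeasurable).mul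
    (by fun_prop : Continuous _).aestronglyMeasurable) (ae_of_all _ fun p => ?_)
  rw [norm_mul, norm_mul, Complex.norm_exp_ofReal_mul_I, mul_one]
  refine le_trans ?_ (Real.le_norm_self _)
  calc ‖(a p.1 + ⟪b p.1, (2 * Real.pi) • p.2⟫ * Complex.I : ℂ)‖ * ‖h p.2‖
      ≤ (‖a p.1‖ + ‖b p.1‖ * (2 * Real.pi * ‖p.2‖)) * ‖h p.2‖ := by
        gcongr
        refine (norm_add_le _ _).trans ?_
        rw [norm_mul, Complex.norm_I, mul_one, Complex.norm_real, Complex.norm_real]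
        gcongr
        refine (norm_inner_le_norm _ _).trans_eq ?_
        rw [norm_smul, Real.norm_of_nonneg Real.two_pi_pos.le]
    _ = _ := by ring

theorem isWeakGradient_gradient_of_hasCompactSupport_of_contDiff_top {μ : Measure V}
    [IsFiniteMeasure μ] {G : V → ℝ} (hG : ContDiff ℝ (⊤ : ℕ∞) G) (hc : HasCompactSupport G) :
    IsWeakGradient μ G (∇ G) := by
  have hcont : Continuous (∇ G) :=
    (LinearIsometryEquiv.continuous _).comp (hG.continuous_fderiv (by simp))
  have hcgrad : HasCompactSupport (∇ G) := (hc.fderiv ℝ).comp_left (map_zero _)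
  refine isWeakGradient_of_forall_integral_eq_zero (hG.continuous.memLp_of_hasCompactSupport hc)
    (hcont.memLp_of_hasCompactSupport hcgrad) fun a b hab => ?_
  obtain ⟨h, hh⟩ := exists_fourier_representation hG hc
  have hΨ := integrable_prod_add_inner_mul_cexp_mul ((Lp.memLp a).integrable (by norm_num))
    ((Lp.memLp b).integrable (by norm_num)) h
  have hre : ((∫ x, (a x * G x + ⟪b x, ∇ G x⟫) ∂μ : ℝ) : ℂ) = 0 := calc
    _ = ∫ x, ∫ w, (a x + ⟪b x, (2 * Real.pi) • w⟫ * Complex.I) *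
        Complex.exp (⟪(2 * Real.pi) • w, x⟫ * Complex.I) * h w ∂volume ∂μ := by
      simp_rw [hh]
      exact integral_complex_ofReal.symm
    _ = ∫ w, ∫ x, (a x + ⟪b x, (2 * Real.pi) • w⟫ * Complex.I) *
        Complex.exp (⟪(2 * Real.pi) • w, x⟫ * Complex.I) * h w ∂μ := integral_integral_swap hΨ
    _ = 0 := by
      simp_rw [integral_mul_const, integral_add_inner_mul_cexp_eq_zero hab, zero_mul,
        integral_zero]
  exact_mod_cast hre

end FiniteDimensional

theorem IsWeakGradient.gradient_of_tendsto {E : Type*} [NormedAddCommGroup E]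
    [InnerProductSpace ℝ E] [CompleteSpace E] [MeasurableSpace E] [BorelSpace E]
    [SecondCountableTopology E] {μ : Measure E} [IsFiniteMeasure μ] {U : ℕ → E → ℝ} {u : E → ℝ}
    (h : ∀ n, IsWeakGradient μ (U n) (∇ (U n))) {C D : ℝ} (hU : ∀ n x, ‖U n x‖ ≤ C)
    (hU' : ∀ n x, ‖fderiv ℝ (U n) x‖ ≤ D) (hu : ∀ x, Tendsto (fun n => U n x) atTop (𝓝 (u x)))
    (hu' : ∀ x, Tendsto (fun n => fderiv ℝ (U n) x) atTop (𝓝 (fderiv ℝ u x))) :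
    IsWeakGradient μ u (∇ u) :=
  .of_tendsto h hU (fun n x => (LinearIsometryEquiv.norm_map _ _).trans_le (hU' n x)) hu
    fun x => ((LinearIsometryEquiv.continuous _).tendsto _).comp (hu' x)

section FiniteDimensional

open ContinuousLinearMap (lsmul)
open scoped Convolution

variable {V : Type*} [NormedAddCommGroup V] [InnerProductSpace ℝ V] [FiniteDimensional ℝ V]
  [MeasurableSpace V] [BorelSpace V]

theorem norm_normed_convolution_le {W : Type*} [NormedAddCommGroup W] [NormedSpace ℝ W]
    [CompleteSpace W] (φ : ContDiffBump (0 : V)) {g : V → W} (hg : Continuous g) {C : ℝ}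
    (hC : ∀ x, ‖g x‖ ≤ C) (x : V) : ‖(φ.normed volume ⋆[lsmul ℝ ℝ] g) x‖ ≤ 3 * C := by
  have hdist := φ.dist_normed_convolution_le (μ := volume) (x₀ := x) (ε := 2 * C)
    hg.aestronglyMeasurable fun y _ => by
      linarith [dist_le_norm_add_norm (g y) (g x), hC x, hC y]
  rw [dist_eq_norm] at hdist
  linarith [norm_le_norm_add_norm_sub' ((φ.normed volume ⋆[lsmul ℝ ℝ] g) x) (g x), hC x]

theorem fderiv_normed_convolution (φ : ContDiffBump (0 : V)) {G : V → ℝ} (hG : ContDiff ℝ 1 G)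
    (hc : HasCompactSupport G) (x : V) :
    fderiv ℝ (φ.normed volume ⋆[lsmul ℝ ℝ] G) x =
      (φ.normed volume ⋆[lsmul ℝ ℝ] fderiv ℝ G) x :=
  (hc.hasFDerivAt_convolution_right (lsmul ℝ ℝ) φ.continuous_normed.locallyIntegrable hG
    x).fderiv

theorem isWeakGradient_gradient_of_hasCompactSupport {μ : Measure V} [IsFiniteMeasure μ]
    {G : V → ℝ} (hG : ContDiff ℝ 1 G) (hc : HasCompactSupport G) : IsWeakGradient μ G (∇ G) := by
  have hG' : Continuous (fderiv ℝ G) := hG.continuous_fderiv one_ne_zero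
  obtain ⟨C, hC⟩ := hc.exists_bound_of_continuous hG.continuous
  obtain ⟨D, hD⟩ := (hc.fderiv ℝ).exists_bound_of_continuous hG'
  let φ (n : ℕ) : ContDiffBump (0 : V) :=
    ⟨1 / (n + 1) / 2, 1 / (n + 1), by positivity, half_lt_self (by positivity)⟩
  have hφ : Tendsto (fun n => (φ n).rOut) atTop (𝓝 0) := tendsto_one_div_add_atTop_nhds_zero_nat
  refine .gradient_of_tendsto (U := fun n => (φ n).normed volume ⋆[lsmul ℝ ℝ] G) (D := 3 * D)
    (fun n => isWeakGradient_gradient_of_hasCompactSupport_of_contDiff_top ?_ ?_)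
    (fun n => norm_normed_convolution_le (φ n) hG.continuous hC) (fun n x => ?_)
    (ContDiffBump.convolution_tendsto_right_of_continuous hφ hG.continuous) fun x => ?_
  · exact (φ n).hasCompactSupport_normed.contDiff_convolution_left _ (φ n).contDiff_normed
      hG.continuous.locallyIntegrable
  · exact (φ n).hasCompactSupport_normed.convolution _ hc
  · rw [fderiv_normed_convolution (φ n) hG hc]
    exact norm_normed_convolution_le (φ n) hG' hD x
  · simp_rw [fderiv_normed_convolution (φ _) hG hc]
    exact ContDiffBump.convolution_tendsto_right_of_continuous hφ hG' x

theorem fderiv_comp_smul_mul {W : Type*} [NormedAddCommGroup W] [NormedSpace ℝ W] {χ G : W → ℝ}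
    (hχ : Differentiable ℝ χ) (hG : Differentiable ℝ G) (c : ℝ) (x : W) :
    fderiv ℝ (fun x => χ (c • x) * G x) x =
      χ (c • x) • fderiv ℝ G x + (c * G x) • fderiv ℝ χ (c • x) := by
  have hχc : DifferentiableAt ℝ (fun x => χ (c • x)) x := (hχ _).comp x (by fun_prop)
  rw [fderiv_fun_mul hχc (hG x), fderiv_comp_smul, smul_smul, mul_comm (G x)]

theorem isWeakGradient_gradient_of_finiteDimensional {μ : Measure V} [IsFiniteMeasure μ]
    {G : V → ℝ} (hG : ContDiff ℝ 1 G) {C D : ℝ} (hC : ∀ x, ‖G x‖ ≤ C)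
    (hD : ∀ x, ‖fderiv ℝ G x‖ ≤ D) : IsWeakGradient μ G (∇ G) := by
  let χ : ContDiffBump (0 : V) := ⟨1, 2, one_pos, one_lt_two⟩
  have hχ : ContDiff ℝ 1 χ := χ.contDiff
  have hχ_le (x : V) : ‖χ x‖ ≤ 1 := (Real.norm_of_nonneg χ.nonneg).trans_le χ.le_one
  obtain ⟨M, hM⟩ := (χ.hasCompactSupport.fderiv ℝ).exists_bound_of_continuous
    (hχ.continuous_fderiv one_ne_zero)
  let c : ℕ → ℝ := fun n => 1 / (n + 1)
  have hc0 (n : ℕ) : 0 < c n := by positivity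
  have hc1 (n : ℕ) : c n ≤ 1 := (div_le_one (by positivity)).2 (by simp)
  have hc : Tendsto c atTop (𝓝 0) := tendsto_one_div_add_atTop_nhds_zero_nat
  have hderiv (n : ℕ) (x : V) := fderiv_comp_smul_mul (hχ.differentiable one_ne_zero)
    (hG.differentiable one_ne_zero) (c n) x
  have hcx (x : V) : Tendsto (fun n => χ (c n • x)) atTop (𝓝 1) := by
    have hlim := χ.continuous.tendsto' 0 1 (χ.one_of_mem_closedBall (by simp [χ.rIn_pos.le]))
    exact hlim.comp (by simpa using hc.smul_const x)
  have hM' (n : ℕ) (x : V) : ‖(c n * G x) • fderiv ℝ χ (c n • x)‖ ≤ c n * (C * M) := by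
    rw [norm_smul, norm_mul, Real.norm_of_nonneg (hc0 n).le, mul_assoc]
    gcongr
    exacts [(norm_nonneg _).trans (hC x), hC x, hM _]
  have hCM : 0 ≤ C * M :=
    mul_nonneg ((norm_nonneg _).trans (hC 0)) ((norm_nonneg _).trans (hM 0))
  refine .gradient_of_tendsto (U := fun n x => χ (c n • x) * G x) (C := C) (D := D + C * M)
    (fun n => isWeakGradient_gradient_of_hasCompactSupport
      ((hχ.comp (contDiff_const_smul (c n))).mul hG)
      (χ.hasCompactSupport.comp_smul (hc0 n).ne').mul_right)
    (fun n x => ?_) (fun n x => ?_) (fun x => by simpa using (hcx x).mul_const (G x)) fun x => ?_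
  · rw [norm_mul]
    exact (mul_le_of_le_one_left (norm_nonneg _) (hχ_le _)).trans (hC x)
  · rw [hderiv]
    refine norm_add_le_of_le ?_ ((hM' n x).trans (mul_le_of_le_one_left hCM (hc1 n)))
    rw [norm_smul]
    exact (mul_le_of_le_one_left (norm_nonneg _) (hχ_le _)).trans (hD x)
  · simp_rw [hderiv]
    have hvanish := squeeze_zero_norm (hM' · x) (by simpa using hc.mul_const (C * M))
    simpa using ((hcx x).smul_const (fderiv ℝ G x)).add hvanish

end FiniteDimensional

section InfiniteDimensional

variable {E : Type*} [NormedAddCommGroup E] [InnerProductSpace ℝ E]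

theorem exists_monotone_finiteDimensional_iSup_dense [SecondCountableTopology E] :
    ∃ U : ℕ → Submodule ℝ E, Monotone U ∧ (∀ n, FiniteDimensional ℝ (U n)) ∧
      (⨆ n, U n).topologicalClosure = ⊤ := by
  let d := TopologicalSpace.denseSeq E
  refine ⟨fun n => .span ℝ (d '' Set.Iio n), fun m n hmn => Submodule.span_mono (by gcongr),
    fun n => .span_of_finite ℝ ((Set.finite_Iio n).image d), ?_⟩
  refine Submodule.dense_iff_topologicalClosure_eq_top.1
    ((TopologicalSpace.denseRange_denseSeq E).mono ?_)
  rintro _ ⟨n, rfl⟩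
  exact Submodule.mem_iSup_of_mem (n + 1)
    (Submodule.subset_span (Set.mem_image_of_mem d n.lt_succ_self))

theorem hasGradientAt_comp_continuousLinearMap [CompleteSpace E] {V : Type*}
    [NormedAddCommGroup V] [InnerProductSpace ℝ V] [CompleteSpace V] (A : E →L[ℝ] V) {G : V → ℝ}
    {g : V} {x : E} (hG : HasGradientAt G g (A x)) :
    HasGradientAt (fun x => G (A x)) (A.adjoint g) x := by
  rw [hasGradientAt_iff_hasFDerivAt] at hG ⊢
  refine (hG.comp x A.hasFDerivAt).congr_fderiv ?_
  ext y
  exact (A.adjoint_inner_left y g).symm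

variable [CompleteSpace E] [MeasurableSpace E] [BorelSpace E] [SecondCountableTopology E]
  {μ : Measure E} [IsFiniteMeasure μ]

theorem isWeakGradient_starProjection {F : E → ℝ} {v : E → E} (hF : ∀ x, HasGradientAt F (v x) x)
    (hv : Continuous v) {C D : ℝ} (hC : ∀ x, ‖F x‖ ≤ C) (hD : ∀ x, ‖v x‖ ≤ D)
    (U : Submodule ℝ E) [FiniteDimensional ℝ U] :
    IsWeakGradient μ (fun x => F (U.starProjection x))
      fun x => U.starProjection (v (U.starProjection x)) := by
  have hgrad (y : U) : HasGradientAt (fun y : U => F y) (U.orthogonalProjectionOnto (v y)) y := by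
    rw [← U.adjoint_subtypeL]
    exact hasGradientAt_comp_continuousLinearMap U.subtypeL (hF y)
  have hG : ContDiff ℝ 1 fun y : U => F y := by
    refine contDiff_one_iff_fderiv.2 ⟨fun y => (hgrad y).differentiableAt, ?_⟩
    rw [← toDual_comp_gradient, gradient_eq hgrad]
    fun_prop
  have hweak := isWeakGradient_gradient_of_finiteDimensional (D := D)
    (μ := μ.map U.orthogonalProjectionOnto) hG (fun y => hC y) fun y => by
      rw [← toDual_gradient, LinearIsometryEquiv.norm_map, (hgrad y).gradient]
      exact (U.norm_orthogonalProjectionOnto_apply_le _).trans (hD y)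
  rw [gradient_eq hgrad] at hweak
  simpa only [U.adjoint_orthogonalProjectionOnto, Submodule.subtypeL_apply,
    ← Submodule.starProjection_apply] using
      hweak.comp_continuousLinearMap U.orthogonalProjectionOnto

theorem isWeakGradient_of_hasGradientAt {F : E → ℝ} {v : E → E}
    (hF : ∀ x, HasGradientAt F (v x) x) (hv : Continuous v) {C D : ℝ} (hC : ∀ x, ‖F x‖ ≤ C)
    (hD : ∀ x, ‖v x‖ ≤ D) : IsWeakGradient μ F v := by
  obtain ⟨U, hU, hUfin, hUdense⟩ := exists_monotone_finiteDimensional_iSup_dense (E := E)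
  have hproj (x : E) : Tendsto (fun n => (U n).starProjection x) atTop (𝓝 x) :=
    Submodule.starProjection_tendsto_self U hU x hUdense.ge
  refine .of_tendsto (fun n => isWeakGradient_starProjection hF hv hC hD (U n)) (fun n x => hC _)
    (fun n x => ((U n).norm_starProjection_apply_le _).trans (hD _))
    (fun x => ((hF x).continuousAt.tendsto).comp (hproj x)) fun x => ?_
  have hvx : Tendsto (fun n => v ((U n).starProjection x) - v x) atTop (𝓝 0) := by
    simpa using ((hv.tendsto x).comp (hproj x)).sub_const (v x)
  have hdiff := squeeze_zero_norm
    (fun n => (U n).norm_starProjection_apply_le (v ((U n).starProjection x) - v x))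
    (tendsto_zero_iff_norm_tendsto_zero.1 hvx)
  simpa using hdiff.add (hproj (v x))

end InfiniteDimensional

section BoundedMultiplication

variable {α : Type*} [MeasurableSpace α] {ν : Measure α} {p q : ℝ≥0∞}

theorem memLp_top_comp {b : ℝ → ℝ} (hb : Measurable b) {C : ℝ} (hC : ∀ x, ‖b x‖ ≤ C)
    (f : Lp ℝ q ν) : MemLp (fun t => b (f t)) ∞ ν :=
  memLp_top_of_bound
    (hb.comp_aemeasurable (Lp.aestronglyMeasurable f).aemeasurable).aestronglyMeasurable C
    (ae_of_all _ fun _ => hC _)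

theorem norm_toLp_smul_le {m : α → ℝ} (hm : MemLp m ∞ ν) {C : ℝ} (hC : ∀ t, ‖m t‖ ≤ C)
    (v : Lp ℝ p ν) : ‖(hm.toLp • v : Lp ℝ p ν)‖ ≤ C * ‖v‖ := by
  refine Lp.norm_le_mul_norm_of_ae_le_mul ?_
  filter_upwards [Lp.coeFn_lpSMul (r := p) hm.toLp v, hm.coeFn_toLp] with t ht ht'
  rw [ht, Pi.smul_apply', ht', norm_smul]
  gcongr
  exact hC t

variable [Fact (1 ≤ p)]

theorem tendsto_toLp_smul (hp : p ≠ ∞) {m : ℕ → α → ℝ} (hm : ∀ n, MemLp (m n) ∞ ν) {b : α → ℝ}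
    (hb : MemLp b ∞ ν) {C : ℝ} (hC : ∀ n t, ‖m n t‖ ≤ C)
    (hlim : ∀ᵐ t ∂ν, Tendsto (fun n => m n t) atTop (𝓝 (b t))) {v : ℕ → Lp ℝ p ν} {w : Lp ℝ p ν}
    (hv : Tendsto v atTop (𝓝 w)) :
    Tendsto (fun n => ((hm n).toLp • v n : Lp ℝ p ν)) atTop (𝓝 (hb.toLp • w)) := by
  have hfix : Tendsto (fun n => ((hm n).toLp • w : Lp ℝ p ν)) atTop (𝓝 (hb.toLp • w)) := by
    refine tendsto_Lp_of_dominated hp ((Lp.memLp w).norm.const_mul C) (fun n => ?_) ?_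
    · filter_upwards [Lp.coeFn_lpSMul (r := p) (hm n).toLp w, (hm n).coeFn_toLp] with t ht ht'
      rw [ht, Pi.smul_apply', ht', norm_smul]
      gcongr
      exact hC n t
    · filter_upwards [ae_all_iff.2 fun n => Lp.coeFn_lpSMul (r := p) (hm n).toLp w,
        ae_all_iff.2 fun n => (hm n).coeFn_toLp, Lp.coeFn_lpSMul (r := p) hb.toLp w,
        hb.coeFn_toLp, hlim] with t ht ht' hbt hbt' hlimt
      simpa only [ht, ht', hbt, hbt', Pi.smul_apply'] using hlimt.smul_const _
  have hvar : Tendsto (fun n => ((hm n).toLp • (v n - w) : Lp ℝ p ν)) atTop (𝓝 0) :=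
    squeeze_zero_norm (fun n => norm_toLp_smul_le (hm n) (hC n) _)
      (by simpa using (tendsto_iff_norm_sub_tendsto_zero.1 hv).const_mul C)
  simpa [← Lp.add_smul] using hvar.add hfix

theorem continuousAt_toLp_smul [Fact (1 ≤ q)] (hp : p ≠ ∞) {k : α → ℝ → ℝ}
    (hk : ∀ x : Lp ℝ q ν, MemLp (fun t => k t (x t)) ∞ ν) {C : ℝ} (hC : ∀ t y, ‖k t y‖ ≤ C)
    {f : Lp ℝ q ν} (hcont : ∀ t, ContinuousAt (k t) (f t)) {v : Lp ℝ q ν → Lp ℝ p ν}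
    (hv : ContinuousAt v f) : ContinuousAt (fun x => ((hk x).toLp • v x : Lp ℝ p ν)) f := by
  refine tendsto_of_seq_tendsto fun x hx => tendsto_of_subseq_tendsto fun ns hns => ?_
  obtain ⟨ms, hms, hae⟩ := (tendstoInMeasure_of_tendsto_Lp (hx.comp hns)).exists_seq_tendsto_ae
  refine ⟨ms, tendsto_toLp_smul hp _ _ (fun n t => hC t _) ?_
    (hv.tendsto.comp ((hx.comp hns).comp hms.tendsto_atTop))⟩
  filter_upwards [hae] with t ht using (hcont t).tendsto.comp ht

end BoundedMultiplication

section Superposition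

variable {α : Type*} [MeasurableSpace α] {ν : Measure α} {φ : ℝ → ℝ} {K : NNReal}

theorem norm_dslope_le_of_lipschitzWith (hL : LipschitzWith K φ) (a b : ℝ) :
    ‖dslope φ a b‖ ≤ K := by
  rcases eq_or_ne b a with rfl | hab
  · simpa using norm_deriv_le_of_lipschitz hL
  · rw [dslope_of_ne _ hab, slope_def_field, norm_div,
      div_le_iff₀ (norm_pos_iff.2 (sub_ne_zero.2 hab))]
    simpa only [dist_eq_norm] using hL.dist_le_mul b a

theorem measurable_uncurry_dslope (hφ : Measurable φ) :
    Measurable (Function.uncurry (dslope φ)) := by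
  have : Function.uncurry (dslope φ) =
      fun z => if z.2 = z.1 then deriv φ z.1 else (φ z.2 - φ z.1) / (z.2 - z.1) := by
    ext z
    split_ifs with h
    · simp [Function.uncurry, h]
    · simp [Function.uncurry, dslope_of_ne _ h, slope_def_field]
  rw [this]
  exact .ite (measurableSet_eq_fun measurable_snd measurable_fst)
    ((measurable_deriv φ).comp measurable_fst) (by fun_prop)

theorem memLp_top_dslope (hL : LipschitzWith K φ) {q : ℝ≥0∞} (f x : Lp ℝ q ν) :
    MemLp (fun t => dslope φ (f t) (x t)) ∞ ν :=
  memLp_top_of_bound ((measurable_uncurry_dslope hL.continuous.measurable).comp_aemeasurable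
    ((Lp.aestronglyMeasurable f).aemeasurable.prodMk
      (Lp.aestronglyMeasurable x).aemeasurable)).aestronglyMeasurable K
    (ae_of_all _ fun _ => norm_dslope_le_of_lipschitzWith hL _ _)

theorem compLp_sub_compLp_eq_dslope_smul (hL : LipschitzWith K φ) (h0 : φ 0 = 0) {q : ℝ≥0∞}
    (f x : Lp ℝ q ν) :
    hL.compLp h0 x - hL.compLp h0 f = (memLp_top_dslope hL f x).toLp • (x - f) := by
  refine Lp.ext ?_
  filter_upwards [Lp.coeFn_sub (hL.compLp h0 x) (hL.compLp h0 f), hL.coeFn_compLp h0 x,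
    hL.coeFn_compLp h0 f, Lp.coeFn_lpSMul (r := q) (memLp_top_dslope hL f x).toLp (x - f),
    (memLp_top_dslope hL f x).coeFn_toLp, Lp.coeFn_sub x f] with t h₁ h₂ h₃ h₄ h₅ h₆
  rw [h₁, Pi.sub_apply, h₂, h₃, h₄, Pi.smul_apply', h₅, h₆, Pi.sub_apply, smul_eq_mul, mul_comm,
    ← smul_eq_mul, sub_smul_dslope]
  rfl

theorem inner_toLp_smul_right {m : α → ℝ} (hm : MemLp m ∞ ν) (v w : Lp ℝ 2 ν) :
    ⟪v, (hm.toLp • w : Lp ℝ 2 ν)⟫ = ⟪(hm.toLp • v : Lp ℝ 2 ν), w⟫ := by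
  refine integral_congr_ae ?_
  filter_upwards [Lp.coeFn_lpSMul (r := 2) hm.toLp v, Lp.coeFn_lpSMul (r := 2) hm.toLp w]
    with t hv hw
  rw [hv, hw, Pi.smul_apply', Pi.smul_apply', real_inner_smul_left, real_inner_smul_right]

/- The superposition operator `x ↦ φ ∘ x` is in general not Fréchet differentiable on `L²`, but its
difference quotients converge strongly as multiplication operators, which is enough after pairing
with a fixed vector. -/
theorem hasGradientAt_comp_compLp (hφ : Differentiable ℝ φ) (hL : LipschitzWith K φ) (h0 : φ 0 = 0)
    {F : Lp ℝ 2 ν → ℝ} {f v : Lp ℝ 2 ν} (hF : HasGradientAt F v (hL.compLp h0 f)) :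
    HasGradientAt (fun x => F (hL.compLp h0 x))
      ((memLp_top_comp (measurable_deriv φ) (fun _ => norm_deriv_le_of_lipschitz hL) f).toLp • v)
      f := by
  set b := (memLp_top_comp (measurable_deriv φ) (fun _ => norm_deriv_le_of_lipschitz hL) f).toLp
  let k (x : Lp ℝ 2 ν) : Lp ℝ 2 ν := (memLp_top_dslope hL f x).toLp • v
  have hkf : k f = b • v := by simp only [k, b, dslope_same]
  have hk : Tendsto (fun x => k x - b • v) (𝓝 f) (𝓝 0) := by
    have hcont : ContinuousAt k f :=
      continuousAt_toLp_smul (by simp) (k := fun t => dslope φ (f t)) (memLp_top_dslope hL f)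
        (fun t => norm_dslope_le_of_lipschitzWith hL (f t))
        (fun t => continuousAt_dslope_same.2 (hφ (f t))) continuousAt_const
    simpa [hkf] using hcont.tendsto.sub_const (b • v)
  have hlin : (fun x => ⟪v, hL.compLp h0 x - hL.compLp h0 f⟫ - ⟪b • v, x - f⟫) =o[𝓝 f]
      fun x => x - f := by
    have heq (x : Lp ℝ 2 ν) : ⟪v, hL.compLp h0 x - hL.compLp h0 f⟫ - ⟪b • v, x - f⟫ =
        ⟪k x - b • v, x - f⟫ := by
      rw [compLp_sub_compLp_eq_dslope_smul, inner_toLp_smul_right, inner_sub_left]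
    simp_rw [heq]
    refine (Asymptotics.isBigO_of_le _ fun x => ?_).trans_isLittleO
      (((Asymptotics.isLittleO_one_iff ℝ).2 hk).norm_left.mul_isBigO
        (Asymptotics.isBigO_refl (fun x => ‖x - f‖) _)) |>.trans_isBigO ?_
    · exact (norm_inner_le_norm _ _).trans (Real.le_norm_self _)
    · simpa using (Asymptotics.isBigO_refl (fun x => x - f) (𝓝 f)).norm_left
  have hcomp : (fun x => F (hL.compLp h0 x) - F (hL.compLp h0 f) -
      ⟪v, hL.compLp h0 x - hL.compLp h0 f⟫) =o[𝓝 f] fun x => x - f :=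
    ((hasGradientAt_iff_isLittleO.1 hF).comp_tendsto
      (hL.continuous_compLp h0).continuousAt.tendsto).trans_isBigO
      (.of_bound K (.of_forall fun x => hL.norm_compLp_sub_le h0 x f))
  refine hasGradientAt_iff_isLittleO.2 ((hcomp.add hlin).congr_left fun x => ?_)
  ring

end Superposition

section SmoothAbs

/-- A smooth approximation of the absolute value, vanishing at `0`. -/
noncomputable def smoothAbs (ε x : ℝ) : ℝ := √(x ^ 2 + ε ^ 2) - ε

variable {ε : ℝ}

theorem smoothAbs_zero (hε : 0 < ε) : smoothAbs ε 0 = 0 := by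
  simp [smoothAbs, Real.sqrt_sq hε.le]

theorem contDiff_smoothAbs (hε : 0 < ε) {n : WithTop ℕ∞} : ContDiff ℝ n (smoothAbs ε) :=
  (ContDiff.sqrt (by fun_prop) fun x => by positivity).sub contDiff_const

theorem deriv_smoothAbs (hε : 0 < ε) (x : ℝ) : deriv (smoothAbs ε) x = x / √(x ^ 2 + ε ^ 2) := by
  have hpos : 0 < x ^ 2 + ε ^ 2 := by positivity
  refine (((hasDerivAt_pow 2 x).add_const (ε ^ 2)).sqrt hpos.ne' |>.sub_const ε).deriv.trans ?_
  rw [Nat.cast_ofNat, Nat.add_one_sub_one, pow_one, mul_div_mul_left _ _ two_ne_zero]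

theorem lipschitzWith_smoothAbs (hε : 0 < ε) : LipschitzWith 1 (smoothAbs ε) := by
  refine lipschitzWith_of_nnnorm_deriv_le ((contDiff_smoothAbs hε).differentiable one_ne_zero)
    fun x => ?_
  rw [← NNReal.coe_le_coe, coe_nnnorm, deriv_smoothAbs hε, norm_div, Real.norm_eq_abs,
    Real.norm_of_nonneg (Real.sqrt_nonneg _), NNReal.coe_one]
  exact div_le_one_of_le₀ (Real.abs_le_sqrt (by nlinarith [sq_nonneg ε])) (Real.sqrt_nonneg _)

theorem tendsto_smoothAbs {c : ℕ → ℝ} (hc : Tendsto c atTop (𝓝 0)) (x : ℝ) :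
    Tendsto (fun n => smoothAbs (c n) x) atTop (𝓝 |x|) := by
  have hcont : Continuous fun ε => smoothAbs ε x := by unfold smoothAbs; fun_prop
  simpa [smoothAbs, Real.sqrt_sq_eq_abs, Function.comp_def] using (hcont.tendsto 0).comp hc

theorem tendsto_deriv_smoothAbs {c : ℕ → ℝ} (hc₀ : ∀ n, 0 < c n) (hc : Tendsto c atTop (𝓝 0))
    (x : ℝ) : Tendsto (fun n => deriv (smoothAbs (c n)) x) atTop (𝓝 (Real.sign x)) := by
  simp_rw [deriv_smoothAbs (hc₀ _)]
  rcases eq_or_ne x 0 with rfl | hx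
  · simp
  have hsqrt : Tendsto (fun n => √(x ^ 2 + c n ^ 2)) atTop (𝓝 |x|) := by
    simpa [← Real.sqrt_sq_eq_abs] using ((hc.pow 2).const_add (x ^ 2)).sqrt
  have hsign : Real.sign x = x / |x| := by
    rcases hx.lt_or_gt with hx | hx
    · rw [Real.sign_of_neg hx, abs_of_neg hx, div_neg, div_self hx.ne]
    · rw [Real.sign_of_pos hx, abs_of_pos hx, div_self hx.ne']
  rw [hsign]
  exact tendsto_const_nhds.div hsqrt (abs_ne_zero.2 hx)

theorem measurable_real_sign : Measurable Real.sign :=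
  .ite measurableSet_Iio measurable_const (.ite measurableSet_Ioi measurable_const measurable_const)

theorem norm_real_sign_le (x : ℝ) : ‖Real.sign x‖ ≤ 1 := by
  rcases Real.sign_apply_eq x with h | h | h <;> simp [h]

end SmoothAbs

section WeakGradient

variable {α : Type*} [MeasurableSpace α] {ν : Measure α} [MeasurableSpace (Lp ℝ 2 ν)]
  [BorelSpace (Lp ℝ 2 ν)] [SecondCountableTopology (Lp ℝ 2 ν)] {μ : Measure (Lp ℝ 2 ν)}
  [IsFiniteMeasure μ] {F : Lp ℝ 2 ν → ℝ} {v : Lp ℝ 2 ν → Lp ℝ 2 ν} {C D : ℝ}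

theorem isWeakGradient_comp_compLp {φ : ℝ → ℝ} (hφ : ContDiff ℝ 1 φ) {K : NNReal}
    (hL : LipschitzWith K φ) (h0 : φ 0 = 0) (hF : ∀ f, HasGradientAt F (v f) f)
    (hv : Continuous v) (hC : ∀ f, ‖F f‖ ≤ C) (hD : ∀ f, ‖v f‖ ≤ D) :
    IsWeakGradient μ (fun f => F (hL.compLp h0 f)) fun f =>
      (memLp_top_comp (measurable_deriv φ) (fun _ => norm_deriv_le_of_lipschitz hL) f).toLp •
        v (hL.compLp h0 f) := by
  refine isWeakGradient_of_hasGradientAt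
    (fun f => hasGradientAt_comp_compLp (hφ.differentiable one_ne_zero) hL h0 (hF _))
    (continuous_iff_continuousAt.2 fun f => ?_) (fun f => hC _) (D := K * D)
    fun f => (norm_toLp_smul_le _ (fun _ => norm_deriv_le_of_lipschitz hL) _).trans
      (by gcongr; exact hD _)
  exact continuousAt_toLp_smul (by simp) (k := fun _ => deriv φ) _
    (fun _ _ => norm_deriv_le_of_lipschitz hL)
    (fun _ => (hφ.continuous_deriv le_rfl).continuousAt)
    (hv.comp (hL.continuous_compLp h0)).continuousAt

theorem isWeakGradient_comp_abs (hF : ∀ f, HasGradientAt F (v f) f) (hv : Continuous v)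
    (hC : ∀ f, ‖F f‖ ≤ C) (hD : ∀ f, ‖v f‖ ≤ D) :
    IsWeakGradient μ (fun f => F |f|) fun f =>
      (memLp_top_comp measurable_real_sign norm_real_sign_le f).toLp • v |f| := by
  let c (n : ℕ) : ℝ := 1 / ((n : ℝ) + 1)
  have hc₀ (n : ℕ) : 0 < c n := by positivity
  have hc : Tendsto c atTop (𝓝 0) := tendsto_one_div_add_atTop_nhds_zero_nat
  have hL (n : ℕ) := lipschitzWith_smoothAbs (hc₀ n)
  have h0 (n : ℕ) := smoothAbs_zero (hc₀ n)
  have hlip (n : ℕ) (x : ℝ) : ‖deriv (smoothAbs (c n)) x‖ ≤ 1 := by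
    simpa using norm_deriv_le_of_lipschitz (hL n)
  have habs (f : Lp ℝ 2 ν) : Tendsto (fun n => (hL n).compLp (h0 n) f) atTop (𝓝 |f|) := by
    refine tendsto_Lp_of_dominated (by simp) (Lp.memLp f).norm (fun n => ?_) ?_
    · filter_upwards [(hL n).coeFn_compLp (h0 n) f] with t ht
      simpa [ht, h0] using (hL n).dist_le_mul (f t) 0
    · filter_upwards [ae_all_iff.2 fun n => (hL n).coeFn_compLp (h0 n) f, Lp.coeFn_abs f]
        with t ht ht'
      simpa only [ht, ht', Function.comp_apply] using tendsto_smoothAbs hc (f t)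
  refine .of_tendsto (fun n => isWeakGradient_comp_compLp (contDiff_smoothAbs (hc₀ n)) (hL n)
    (h0 n) hF hv hC hD) (fun n f => hC _) (D := 1 * D) (fun n f => ?_)
    (fun f => (hF _).continuousAt.tendsto.comp (habs f)) fun f => ?_
  · exact (norm_toLp_smul_le (memLp_top_comp (measurable_deriv _) (hlip n) f)
      (fun t => hlip n (f t)) _).trans (by gcongr; exact hD _)
  · exact tendsto_toLp_smul (by simp) (fun n => memLp_top_comp (measurable_deriv _) (hlip n) f) _
      (fun n t => hlip n (f t)) (ae_of_all _ fun t => tendsto_deriv_smoothAbs hc₀ hc _)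
      ((hv.tendsto _).comp (habs f))

end WeakGradient

section GradientRelation

variable {E : Type*} [NormedAddCommGroup E] [InnerProductSpace ℝ E] [CompleteSpace E]

theorem hasGradientAt_cos_inner_add (ξ x : E) (α : ℝ) :
    HasGradientAt (fun x => Real.cos (⟪ξ, x⟫ + α)) (-Real.sin (⟪ξ, x⟫ + α) • ξ) x := by
  rw [hasGradientAt_iff_hasFDerivAt]
  refine (((innerSL ℝ ξ).hasFDerivAt (x := x)).add_const α).cos.congr_fderiv ?_
  ext y
  simp

variable [MeasurableSpace E] [BorelSpace E] [SecondCountableTopology E]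

/-- The relation between a differentiable function `F` and pairs `(u, v)` representing `F` and its
gradient `μ`-almost everywhere. -/
noncomputable def gradientRelation (μ : Measure E) :
    Submodule ℝ ((E → ℝ) × (Lp ℝ 2 μ × Lp E 2 μ)) where
  carrier := {z | Differentiable ℝ z.1 ∧ z.2.1 =ᵐ[μ] z.1 ∧ z.2.2 =ᵐ[μ] ∇ z.1}
  zero_mem' := by
    refine ⟨differentiable_const 0, Lp.coeFn_zero _ _ _, (Lp.coeFn_zero _ _ _).trans ?_⟩
    exact .of_eq (gradient_eq fun x => hasGradientAt_const x 0).symm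
  add_mem' := by
    rintro ⟨F, u, v⟩ ⟨F', u', v'⟩ ⟨hF, hu, hv⟩ ⟨hF', hu', hv'⟩
    refine ⟨hF.add hF', (Lp.coeFn_add _ _).trans (hu.add hu'),
      (Lp.coeFn_add _ _).trans ((hv.add hv').trans (.of_eq ?_))⟩
    ext1 x
    simp only [Pi.add_apply, gradient, Prod.fst_add, fderiv_add (hF x) (hF' x), map_add]
  smul_mem' := by
    rintro c ⟨F, u, v⟩ ⟨hF, hu, hv⟩
    refine ⟨hF.const_smul c, (Lp.coeFn_smul _ _).trans (hu.const_smul c),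
      (Lp.coeFn_smul _ _).trans ((hv.const_smul c).trans (.of_eq ?_))⟩
    ext1 x
    simp only [Pi.smul_apply, gradient, Prod.smul_fst, fderiv_const_smul (hF x), map_smul]

theorem cosPair_mem_gradientRelation (μ : Measure E) [IsFiniteMeasure μ] (ξ : E) (α : ℝ) :
    ((fun x => Real.cos (⟪ξ, x⟫ + α)), cosPair μ ξ α) ∈ gradientRelation μ := by
  refine ⟨fun x => (hasGradientAt_cos_inner_add ξ x α).differentiableAt,
    (memLp_cos_inner_add ξ α 2).coeFn_toLp, ?_⟩
  rw [gradient_eq fun x => hasGradientAt_cos_inner_add ξ x α]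
  exact (memLp_neg_sin_inner_add_smul ξ α 2).coeFn_toLp

end GradientRelation

section TrigSpan

variable {S : Set L01} {μ : Measure L01} [IsFiniteMeasure μ]

theorem trigSpan_eq_span_cos_inner_add (S : Set L01) :
    trigSpan S = Submodule.span ℝ {F | ∃ ξ ∈ S, ∃ α, F = fun f => Real.cos (⟪ξ, f⟫ + α)} := by
  refine le_antisymm (Submodule.span_mono ?_) (Submodule.span_le.2 ?_)
  · rintro _ (⟨ξ, hξ, rfl⟩ | ⟨ξ, hξ, rfl⟩)
    · exact ⟨ξ, hξ, -(Real.pi / 2), by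
        simp only [← sub_eq_add_neg, Real.cos_sub_pi_div_two]⟩
    · exact ⟨ξ, hξ, 0, by simp only [add_zero]⟩
  · rintro _ ⟨ξ, hξ, α, rfl⟩
    have hsin : (fun f : L01 => Real.sin ⟪ξ, f⟫) ∈ trigSpan S :=
      Submodule.subset_span (.inl ⟨ξ, hξ, rfl⟩)
    have hcos : (fun f : L01 => Real.cos ⟪ξ, f⟫) ∈ trigSpan S :=
      Submodule.subset_span (.inr ⟨ξ, hξ, rfl⟩)
    have hadd : (fun f : L01 => Real.cos (⟪ξ, f⟫ + α)) =
        Real.cos α • (fun f => Real.cos ⟪ξ, f⟫) - Real.sin α • fun f => Real.sin ⟪ξ, f⟫ := by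
      ext f
      simp only [Real.cos_add, Pi.sub_apply, Pi.smul_apply, smul_eq_mul]
      ring
    rw [hadd]
    exact sub_mem (Submodule.smul_mem _ _ hcos) (Submodule.smul_mem _ _ hsin)

/- Both `trigSpan S` and `trigGraph μ S` are projections of the span of the pairs
`(cos (⟪ξ, ·⟫ + α), cosPair μ ξ α)`, which lies in the gradient relation. -/
theorem exists_submodule_map_fst_eq_trigSpan (μ : Measure L01) [IsFiniteMeasure μ] (S : Set L01) :
    ∃ T ≤ gradientRelation μ, T.map (LinearMap.fst ℝ _ _) = trigSpan S ∧
      T.map (LinearMap.snd ℝ _ _) = trigGraph μ S := by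
  refine ⟨.span ℝ {z | ∃ ξ ∈ S, ∃ α, z = ((fun f => Real.cos (⟪ξ, f⟫ + α)), cosPair μ ξ α)},
    Submodule.span_le.2 ?_, ?_, ?_⟩
  · rintro _ ⟨ξ, -, α, rfl⟩
    exact cosPair_mem_gradientRelation μ ξ α
  · rw [trigSpan_eq_span_cos_inner_add, Submodule.map_span]
    congr 1
    exact Set.ext fun F => ⟨by rintro ⟨_, ⟨ξ, hξ, α, rfl⟩, rfl⟩; exact ⟨ξ, hξ, α, rfl⟩,
      by rintro ⟨ξ, hξ, α, rfl⟩; exact ⟨_, ⟨ξ, hξ, α, rfl⟩, rfl⟩⟩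
  · rw [trigGraph, Submodule.map_span]
    congr 1
    exact Set.ext fun p => ⟨by rintro ⟨_, ⟨ξ, hξ, α, rfl⟩, rfl⟩; exact ⟨ξ, hξ, α, rfl⟩,
      by rintro ⟨ξ, hξ, α, rfl⟩; exact ⟨_, ⟨ξ, hξ, α, rfl⟩, rfl⟩⟩

theorem exists_mem_trigGraph {F : L01 → ℝ} (hF : F ∈ trigSpan S) :
    ∃ p ∈ trigGraph μ S, p.1 =ᵐ[μ] F ∧ p.2 =ᵐ[μ] ∇ F := by
  obtain ⟨T, hT, hfst, hsnd⟩ := exists_submodule_map_fst_eq_trigSpan μ S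
  rw [← hfst] at hF
  obtain ⟨z, hz, rfl⟩ := hF
  exact ⟨z.2, hsnd ▸ Submodule.mem_map_of_mem hz, (hT hz).2⟩

theorem mem_trigGraph_iff {p : Lp ℝ 2 μ × Lp L01 2 μ} :
    p ∈ trigGraph μ S ↔ ∃ F ∈ trigSpan S, p.1 =ᵐ[μ] F ∧ p.2 =ᵐ[μ] ∇ F := by
  constructor
  · obtain ⟨T, hT, hfst, hsnd⟩ := exists_submodule_map_fst_eq_trigSpan μ S
    rw [← hsnd]
    rintro ⟨z, hz, rfl⟩
    exact ⟨z.1, hfst ▸ Submodule.mem_map_of_mem hz, (hT hz).2⟩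
  · rintro ⟨F, hF, hp₁, hp₂⟩
    obtain ⟨q, hq, hq₁, hq₂⟩ := exists_mem_trigGraph (μ := μ) hF
    rwa [show p = q from Prod.ext (Lp.ext (hp₁.trans hq₁.symm)) (Lp.ext (hp₂.trans hq₂.symm))]

end TrigSpan

section GreenFunction

variable {φ : ℝ → ℝ}

theorem integral_affine_mul_deriv_deriv (hφ : ContDiff ℝ 2 φ) (a b p q : ℝ) :
    ∫ s in a..b, (p + q * s) * deriv (deriv φ) s =
      (p + q * b) * deriv φ b - (p + q * a) * deriv φ a - q * (φ b - φ a) := by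
  have hφ' : ContDiff ℝ 1 (deriv φ) := hφ.deriv'
  have hderiv (s : ℝ) : HasDerivAt φ (deriv φ s) s :=
    (hφ.differentiable two_ne_zero s).hasDerivAt
  have hderiv₂ (s : ℝ) : HasDerivAt (deriv φ) (deriv (deriv φ) s) s :=
    (hφ'.differentiable one_ne_zero s).hasDerivAt
  have haffine (s : ℝ) : HasDerivAt (fun s => p + q * s) q s := by
    simpa using ((hasDerivAt_id s).const_mul q).const_add p
  rw [intervalIntegral.integral_mul_deriv_eq_deriv_mul (fun s _ => haffine s)
      (fun s _ => hderiv₂ s) intervalIntegrable_const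
      ((hφ'.continuous_deriv le_rfl).intervalIntegrable a b),
    intervalIntegral.integral_const_mul, intervalIntegral.integral_eq_sub_of_hasDerivAt
      (fun s _ => hderiv s) (hφ'.continuous.intervalIntegrable a b)]

/- `min t s - t * s` is the Green function of `-d²/ds²` with Dirichlet boundary conditions. -/
theorem integral_bridgeKernel_mul_deriv_deriv (hφ : ContDiff ℝ 2 φ) (h0 : φ 0 = 0) (h1 : φ 1 = 0)
    {t : ℝ} (ht : t ∈ Set.Icc (0 : ℝ) 1) :
    ∫ s, (min t s - t * s) * deriv (deriv φ) s ∂vol01 = -φ t := by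
  have hφ' : ContDiff ℝ 1 (deriv φ) := hφ.deriv'
  have hcont : Continuous fun s => (min t s - t * s) * deriv (deriv φ) s := by
    have := hφ'.continuous_deriv le_rfl
    fun_prop
  have hleft : ∫ s in (0 : ℝ)..t, (min t s - t * s) * deriv (deriv φ) s =
      ∫ s in (0 : ℝ)..t, (0 + (1 - t) * s) * deriv (deriv φ) s := by
    refine intervalIntegral.integral_congr fun s hs => ?_
    rw [Set.uIcc_of_le ht.1] at hs
    simp only [min_eq_right hs.2]
    ring
  have hright : ∫ s in t..1, (min t s - t * s) * deriv (deriv φ) s =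
      ∫ s in t..1, (t + -t * s) * deriv (deriv φ) s := by
    refine intervalIntegral.integral_congr fun s hs => ?_
    rw [Set.uIcc_of_le ht.2] at hs
    simp only [min_eq_left hs.1]
    ring
  calc ∫ s, (min t s - t * s) * deriv (deriv φ) s ∂vol01
      = ∫ s in (0 : ℝ)..1, (min t s - t * s) * deriv (deriv φ) s := by
        rw [intervalIntegral.integral_of_le zero_le_one, integral_Ioc_eq_integral_Ioo]
    _ = ((0 + (1 - t) * t) * deriv φ t - (0 + (1 - t) * 0) * deriv φ 0 - (1 - t) * (φ t - φ 0)) +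
          ((t + -t * 1) * deriv φ 1 - (t + -t * t) * deriv φ t - -t * (φ 1 - φ t)) := by
        rw [← intervalIntegral.integral_add_adjacent_intervals (b := t)
          (hcont.intervalIntegrable _ _) (hcont.intervalIntegrable _ _), hleft, hright,
          integral_affine_mul_deriv_deriv hφ, integral_affine_mul_deriv_deriv hφ]
    _ = -φ t := by
        rw [h0, h1]
        ring

end GreenFunction

section TestFunctions

/-- The classes of smooth functions with compact support in `(0, 1)`. -/
noncomputable def testFunctions01 : Submodule ℝ L01 where
  carrier := {η | ∃ φ : ℝ → ℝ, ContDiff ℝ (⊤ : ℕ∞) φ ∧ tsupport φ ⊆ Set.Ioo 0 1 ∧ η =ᵐ[vol01] φ}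
  zero_mem' := ⟨0, contDiff_const, by simp [tsupport], Lp.coeFn_zero _ _ _⟩
  add_mem' := by
    rintro η ξ ⟨φ, hφ, hφs, hη⟩ ⟨ψ, hψ, hψs, hξ⟩
    exact ⟨φ + ψ, hφ.add hψ, (tsupport_add φ ψ).trans (Set.union_subset hφs hψs),
      (Lp.coeFn_add η ξ).trans (hη.add hξ)⟩
  smul_mem' := by
    rintro c η ⟨φ, hφ, hφs, hη⟩
    exact ⟨c • φ, contDiff_const.smul hφ, (tsupport_smul_subset_right (fun _ => c) φ).trans hφs,
      (Lp.coeFn_smul c η).trans (hη.const_smul c)⟩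

theorem memLp_vol01_of_continuousOn {φ : ℝ → ℝ} (hφ : ContinuousOn φ (Set.Icc 0 1)) (p : ℝ≥0∞) :
    MemLp φ p vol01 := by
  obtain ⟨C, hC⟩ := isCompact_Icc.exists_bound_of_continuousOn hφ
  refine .of_bound ((hφ.mono Set.Ioo_subset_Icc_self).aestronglyMeasurable measurableSet_Ioo) C ?_
  filter_upwards [ae_restrict_mem measurableSet_Ioo] with t ht
  exact hC t (Set.Ioo_subset_Icc_self ht)

theorem dense_testFunctions01 : Dense (testFunctions01 : Set L01) := by
  rw [Submodule.dense_iff_topologicalClosure_eq_top, Submodule.topologicalClosure_eq_top_iff,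
    Submodule.eq_bot_iff]
  intro η hη
  have hloc : LocallyIntegrableOn η (Set.Ioo 0 1) volume :=
    IntegrableOn.locallyIntegrableOn ((Lp.memLp η).integrable one_le_two)
  rw [Lp.eq_zero_iff_ae_eq_zero]
  refine (ae_restrict_iff' measurableSet_Ioo).2
    (isOpen_Ioo.ae_eq_zero_of_integral_contDiff_smul_eq_zero hloc fun φ hφ _ hφs => ?_)
  have hmem := memLp_vol01_of_continuousOn hφ.continuous.continuousOn 2
  calc ∫ t, φ t • η t = ∫ t, φ t • η t ∂vol01 :=
        (setIntegral_eq_integral_of_forall_compl_eq_zero fun t ht => by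
          rw [image_eq_zero_of_notMem_tsupport fun h => ht (hφs h), zero_smul]).symm
    _ = ⟪hmem.toLp, η⟫ := by
        simp only [inner_toLp_left, RCLike.inner_apply, conj_trivial, mul_comm, smul_eq_mul]
    _ = 0 := hη _ ⟨φ, hφ, hφs, hmem.coeFn_toLp⟩

theorem dense_smooth01 : Dense smooth01 :=
  dense_testFunctions01.mono <| by
    rintro η ⟨φ, hφ, -, hη⟩
    exact ⟨φ, hφ.contDiffOn, hη⟩

theorem IsBrownianBridgeLaw.exists_covarianceBilin_eq_inner {μ : Measure L01}
    (hμ : IsBrownianBridgeLaw μ) {R : L01} (hR : R ∈ testFunctions01) :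
    ∃ η, ∀ ξ, covarianceBilin μ ξ η = ⟪ξ, R⟫ := by
  obtain ⟨φ, hφ, hφs, hRφ⟩ := hR
  have hφ₂ : ContDiff ℝ 2 φ := contDiff_infty.1 hφ 2
  have h0 : φ 0 = 0 := image_eq_zero_of_notMem_tsupport fun h => (hφs h).1.false
  have h1 : φ 1 = 0 := image_eq_zero_of_notMem_tsupport fun h => (hφs h).2.false
  have hmem := memLp_vol01_of_continuousOn (hφ₂.deriv'.continuous_deriv le_rfl).continuousOn 2
  refine ⟨-hmem.toLp, fun ξ => ?_⟩
  have hgreen : ∀ t ∈ Set.Ioo (0 : ℝ) 1,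
      ∫ s, (min t s - t * s) * hmem.toLp (deriv (deriv φ)) s ∂vol01 = -φ t := by
    intro t ht
    rw [← integral_bridgeKernel_mul_deriv_deriv hφ₂ h0 h1 (Set.Ioo_subset_Icc_self ht)]
    refine integral_congr_ae ?_
    filter_upwards [hmem.coeFn_toLp] with s hs
    rw [hs]
  rw [map_neg, covarianceBilin_comm, hμ.covariance_eq, L2.inner_def, ← integral_neg]
  refine integral_congr_ae ?_
  filter_upwards [hRφ, ae_restrict_mem measurableSet_Ioo] with t ht htmem
  rw [hgreen t htmem, ht, neg_mul, neg_neg, RCLike.inner_apply, conj_trivial, mul_comm]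

end TestFunctions

section CylindricalFunctions

variable {F : L01 → ℝ}

theorem contDiff_of_mem_cylindricalCbInfty (hF : F ∈ cylindricalCbInfty) : ContDiff ℝ 1 F := by
  obtain ⟨k, g, η, hg, rfl⟩ := hF
  exact (contDiff_infty.1 hg.1 1).comp (contDiff_pi.2 fun i => (innerSL ℝ (η i)).contDiff)

theorem exists_norm_le_of_mem_cylindricalCbInfty (hF : F ∈ cylindricalCbInfty) :
    ∃ C, ∀ f, ‖F f‖ ≤ C := by
  obtain ⟨k, g, η, hg, rfl⟩ := hF
  obtain ⟨C, hC⟩ := hg.2 0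
  simp only [norm_iteratedFDeriv_zero] at hC
  exact ⟨C, fun f => hC _⟩

theorem exists_norm_gradient_le_of_mem_cylindricalCbInfty (hF : F ∈ cylindricalCbInfty) :
    ∃ D, ∀ f, ‖∇ F f‖ ≤ D := by
  obtain ⟨k, g, η, hg, rfl⟩ := hF
  obtain ⟨D, hD⟩ := hg.2 1
  simp only [norm_iteratedFDeriv_one] at hD
  let T : L01 →L[ℝ] Fin k → ℝ := .pi fun i => innerSL ℝ (η i)
  refine ⟨D * ‖T‖, fun f => ?_⟩
  have hderiv : HasFDerivAt (fun f => g (T f)) (fderiv ℝ g (T f) ∘L T) f :=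
    (hg.1.differentiable (by simp) _).hasFDerivAt.comp f T.hasFDerivAt
  calc ‖∇ (fun f => g (T f)) f‖ = ‖fderiv ℝ g (T f) ∘L T‖ := by
        rw [gradient, LinearIsometryEquiv.norm_map, hderiv.fderiv]
    _ ≤ ‖fderiv ℝ g (T f)‖ * ‖T‖ := ContinuousLinearMap.opNorm_comp_le _ _
    _ ≤ D * ‖T‖ := by gcongr; exact hD _

end CylindricalFunctions

section BrownianBridge

variable {u : Lp ℝ 2 brownianBridgeLaw} {v v' : Lp L01 2 brownianBridgeLaw} {F : L01 → ℝ}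

instance : IsGaussian brownianBridgeLaw := isBrownianBridgeLaw_brownianBridgeLaw.isGaussian

theorem hasWeakGradient_iff :
    HasWeakGradient u v ↔ (u, v) ∈ weakGradientGraph brownianBridgeLaw := by
  rw [weakGradientGraph, ← SetLike.mem_coe, Submodule.topologicalClosure_coe, HasWeakGradient]
  congr! 2
  ext p
  exact mem_trigGraph_iff.symm

theorem HasWeakGradient.unique (hv : HasWeakGradient u v) (hv' : HasWeakGradient u v') : v = v' :=
  eq_of_mem_weakGradientGraph isBrownianBridgeLaw_brownianBridgeLaw.mean_eq_zero
    (dense_testFunctions01.mono fun _ =>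
      isBrownianBridgeLaw_brownianBridgeLaw.exists_covarianceBilin_eq_inner)
    (hasWeakGradient_iff.1 hv) (hasWeakGradient_iff.1 hv')

theorem HasWeakGradient.weakGradient_eq (hv : HasWeakGradient u v) : weakGradient u = v := by
  have hex : ∃ v, HasWeakGradient u v := ⟨v, hv⟩
  rw [weakGradient, dif_pos hex]
  exact hex.choose_spec.unique hv

theorem exists_sobolevW12_comp_abs (hF : F ∈ cylindricalCbInfty) :
    ∃ u ∈ sobolevW12, (u =ᵐ[brownianBridgeLaw] fun f => F |f|) ∧
      ∀ᵐ f ∂brownianBridgeLaw,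
        weakGradient u f =ᵐ[vol01] fun t => Real.sign (f t) * (∇ F |f|) t := by
  have hF₁ := contDiff_of_mem_cylindricalCbInfty hF
  obtain ⟨C, hC⟩ := exists_norm_le_of_mem_cylindricalCbInfty hF
  obtain ⟨D, hD⟩ := exists_norm_gradient_le_of_mem_cylindricalCbInfty hF
  have hcont : Continuous (∇ F) :=
    (InnerProductSpace.toDual ℝ L01).symm.continuous.comp (hF₁.continuous_fderiv one_ne_zero)
  obtain ⟨hu, hv, huv⟩ := isWeakGradient_comp_abs (μ := brownianBridgeLaw)
    (fun f => (hF₁.differentiable one_ne_zero f).hasGradientAt) hcont hC hD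
  rw [← hasWeakGradient_iff] at huv
  refine ⟨hu.toLp, ⟨_, huv⟩, hu.coeFn_toLp, ?_⟩
  rw [huv.weakGradient_eq]
  filter_upwards [hv.coeFn_toLp] with f hf
  rw [hf]
  filter_upwards [Lp.coeFn_lpSMul (r := 2)
    (memLp_top_comp measurable_real_sign norm_real_sign_le f).toLp (∇ F |f|),
    (memLp_top_comp measurable_real_sign norm_real_sign_le f).coeFn_toLp] with t hsmul hsign
  rw [hsmul, Pi.smul_apply', hsign, smul_eq_mul]

theorem hasWeakGradient_of_mem_trigGraph {S : Set L01}
    {p : Lp ℝ 2 brownianBridgeLaw × Lp L01 2 brownianBridgeLaw}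
    (hp : p ∈ trigGraph brownianBridgeLaw S) : HasWeakGradient p.1 p.2 :=
  hasWeakGradient_iff.2 (trigGraph_le_weakGradientGraph S hp)

theorem exists_sobolevW12_of_mem_expSmooth (hF : F ∈ expSmooth) :
    ∃ w ∈ sobolevW12, w =ᵐ[brownianBridgeLaw] F := by
  obtain ⟨p, hp, hpF, -⟩ := exists_mem_trigGraph (μ := brownianBridgeLaw) hF
  exact ⟨p.1, ⟨p.2, hasWeakGradient_of_mem_trigGraph hp⟩, hpF⟩

theorem HasWeakGradient.sobolevNorm_sub_lt {w : Lp ℝ 2 brownianBridgeLaw}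
    (hu : HasWeakGradient u v) (hw : HasWeakGradient w v') {ε : ℝ} (hε : dist (u, v) (w, v') < ε) :
    sobolevNorm (u - w) < √2 * ε := by
  have hsub : HasWeakGradient (u - w) (v - v') :=
    hasWeakGradient_iff.2 (sub_mem (hasWeakGradient_iff.1 hu) (hasWeakGradient_iff.1 hw))
  rw [Prod.dist_eq, max_lt_iff, dist_eq_norm, dist_eq_norm] at hε
  have hε₀ : 0 < ε := (norm_nonneg _).trans_lt hε.1
  rw [sobolevNorm, hsub.weakGradient_eq, Real.sqrt_lt' (by positivity), mul_pow,
    Real.sq_sqrt zero_le_two, two_mul]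
  gcongr
  exacts [hε.1, hε.2]

theorem exists_expSmooth_sobolevNorm_sub_lt (hu : u ∈ sobolevW12) {ε : ℝ} (hε : 0 < ε) :
    ∃ F ∈ expSmooth, ∃ w ∈ sobolevW12, w =ᵐ[brownianBridgeLaw] F ∧ sobolevNorm (u - w) < ε := by
  obtain ⟨v, huv⟩ := hu
  have hmem := hasWeakGradient_iff.1 huv
  rw [← topologicalClosure_trigGraph_of_dense dense_smooth01] at hmem
  obtain ⟨p, hp, hdist⟩ := Metric.mem_closure_iff.1 hmem (ε / √2) (by positivity)
  obtain ⟨F, hF, hpF, -⟩ := mem_trigGraph_iff.1 hp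
  have hpw := hasWeakGradient_of_mem_trigGraph hp
  refine ⟨F, hF, p.1, ⟨p.2, hpw⟩, hpF, ?_⟩
  simpa only [mul_div_cancel₀ ε (Real.sqrt_ne_zero'.2 two_pos)] using
    huv.sobolevNorm_sub_lt hpw hdist

end BrownianBridge

theorem theorem4p2 :
    -- the weak gradient is well defined
    (∀ u v v', HasWeakGradient u v → HasWeakGradient u v' → v = v') ∧
    -- `F ∘ |·| ∈ W^{1,2}`, with weak gradient `sgn(·) ∇F ∘ |·|`
    (∀ F ∈ cylindricalCbInfty, ∃ u ∈ sobolevW12,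
      (u =ᵐ[brownianBridgeLaw] fun f => F |f|) ∧
      ∀ᵐ f ∂brownianBridgeLaw,
        weakGradient u f =ᵐ[vol01] fun t => Real.sign (f t) * (∇ F |f|) t) ∧
    -- `exp(C^∞)` is contained in and dense in `W^{1,2}`
    (∀ F ∈ expSmooth, ∃ w ∈ sobolevW12, w =ᵐ[brownianBridgeLaw] F) ∧
    (∀ u ∈ sobolevW12, ∀ ε > (0 : ℝ), ∃ F ∈ expSmooth, ∃ w ∈ sobolevW12,
      w =ᵐ[brownianBridgeLaw] F ∧ sobolevNorm (u - w) < ε) := by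
  exact ⟨fun u v v' hv hv' => hv.unique hv', fun F hF => exists_sobolevW12_comp_abs hF,
    fun F hF => exists_sobolevW12_of_mem_expSmooth hF,
    fun u hu ε hε => exists_expSmooth_sobolevNorm_sub_lt hu hε⟩
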